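/- Equip $\mathrm{SU}(2)$ with its normalized Haar measure. For a real cutoff $\Lambda\ge 1/2$ let $\mathcal H^{(\Lambda)}$ be the (finite-dimensional) real space of real-valued functions on $\mathrm{SU}(2)^3$ that are complex linear combinations of products $D^{j_1}_{a_1b_1}(g_1)D^{j_2}_{a_2b_2}(g_2)D^{j_3}_{a_3b_3}(g_3)$ of matrix elements of the irreducible representations of $\mathrm{SU}(2)$ of spins $j_1,j_2,j_3\in\{0,\tfrac12,1,\dots\}$, all $\le\Lambda$. Let $C^{(\Lambda)}(g;g')$ be the integral kernel (with $C^{(\Lambda)}(g;\cdot)\in\mathcal H^{(\Lambda)}$ for every $g$) of the restriction to $\mathcal H^{(\Lambda)}$ of the symmetrizer $$(C_\phi\,\phi)(g_1,g_2,g_3)=\frac13\sum_{c}\int dh\;\phi(g_{c(1)}h,g_{c(2)}h,g_{c(3)}h),$$ where $c$ runs over the three cyclic permutations of $\{1,2,3\}$. For a real parameter $\delta$ with $|\delta|\le 1$, the Boulatov-Freidel-Louapre (BFL) model with cutoff $\Lambda$ has covariance $C^{(\Lambda)}$ and weight $e^{-\frac{\lambda}{8}(P[\phi]+\delta T[\phi])}$,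 with the tetrahedron and pillow interactions $$T[\phi]=\int\prod_{i=1}^6dg_i\;\phi(g_1,g_2,g_3)\phi(g_3,g_4,g_5)\phi(g_5,g_2,g_6)\phi(g_6,g_4,g_1),$$ $$P[\phi]=\int\prod_{i=1}^6dg_i\;\phi(g_1,g_2,g_3)\phi(g_3,g_4,g_5)\phi(g_5,g_4,g_6)\phi(g_6,g_2,g_1).$$ A BFL vacuum graph $G$ of order $n$ consists of $n$ vertices, each of which is a tetrahedron or a pillow with its four fields, and of $2n$ lines that contract the $4n$ fields in pairs. Its amplitude $\mathcal A^{BFL}_G$ (the power $\lambda^n$ being stripped off) is the product of a factor $-\tfrac18$ for each pillow and $-\tfrac{\delta}{8}$ for each tetrahedron, times the integral over the $6n$ group variables of the vertices of the product over the lines of $C^{(\Lambda)}$ evaluated at the arguments of the two contracted fields. Theorem 2. There exists a constant $K>0$ such that for every $\delta$ with $|\delta|\le1$, every $\Lambda\ge\frac12$, every $n\ge1$ and every connected BFL vacuum graph $G$ of order $n$, $$|\mathcal A^{BFL}_G|\le K^n\Lambda^{6+3n}.$$ -/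

import Mathlib

open MeasureTheory

noncomputable section

namespace BFL

/-! ### The group SU(2) with its normalized Haar measure -/

/-- The group `SU(2)`. -/
abbrev SU2 : Type := ↥(Matrix.specialUnitaryGroup (Fin 2) ℂ)

instance : SecondCountableTopology SU2 := by
  have : SecondCountableTopology (Matrix (Fin 2) (Fin 2) ℂ) :=
    inferInstanceAs (SecondCountableTopology (Fin 2 → Fin 2 → ℂ))
  exact TopologicalSpace.Subtype.secondCountableTopology
    (Matrix.specialUnitaryGroup (Fin 2) ℂ : Set (Matrix (Fin 2) (Fin 2) ℂ))

instance : IsTopologicalGroup SU2 where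
  continuous_mul := continuous_mul
  continuous_inv := by
    refine Continuous.subtype_mk ?_ _
    exact continuous_star.comp continuous_subtype_val

instance : CompactSpace SU2 := by
  refine isCompact_iff_compactSpace (s := (Matrix.specialUnitaryGroup (Fin 2) ℂ :
    Set (Matrix (Fin 2) (Fin 2) ℂ))).1 ?_
  have hK : IsCompact (Set.univ.pi fun _ : Fin 2 => Set.univ.pi fun _ : Fin 2 =>
      Metric.closedBall (0 : ℂ) 1) :=
    isCompact_univ_pi fun _ => isCompact_univ_pi fun _ => isCompact_closedBall _ _
  have hc : IsClosed ((Matrix.specialUnitaryGroup (Fin 2) ℂ : Set (Matrix (Fin 2) (Fin 2) ℂ))) := by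
    have : ((Matrix.specialUnitaryGroup (Fin 2) ℂ : Set (Matrix (Fin 2) (Fin 2) ℂ))) =
        {A | A * star A = 1} ∩ {A | A.det = 1} := by
      ext A
      simp [Matrix.mem_specialUnitaryGroup_iff, Matrix.mem_unitaryGroup_iff]
    rw [this]
    exact (isClosed_eq (by fun_prop) continuous_const).inter
      (isClosed_eq (Continuous.matrix_det continuous_id) continuous_const)
  refine IsCompact.of_isClosed_subset hK hc ?_
  intro A hA i _ j _
  refine mem_closedBall_zero_iff.2 ?_
  exact entry_norm_bound_of_unitary (Matrix.mem_specialUnitaryGroup_iff.1 hA).1 i j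

instance : MeasurableSpace SU2 := borel SU2

instance : BorelSpace SU2 := ⟨rfl⟩

/-- `SU(2)` carries its normalized Haar measure; finite powers of `SU(2)` then carry the product
of these measures. -/
instance : MeasureSpace SU2 := ⟨Measure.haarMeasure ⊤⟩

instance : Measure.IsHaarMeasure (volume : Measure SU2) :=
  inferInstanceAs (Measure.IsHaarMeasure (Measure.haarMeasure ⊤))

instance : IsProbabilityMeasure (volume : Measure SU2) :=
  ⟨Measure.haarMeasure_self⟩

/-! ### Spins and the truncated space of fields -/

open Polynomial in
/-- The matrix `D^j(g)` of `g` in the irreducible representation of spin `j = m / 2` (dimension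
`m + 1`): the action of `g` on homogeneous polynomials of degree `m` in two variables `e₁, e₂`,
`e₁ ↦ g₀₀ e₁ + g₁₀ e₂`, `e₂ ↦ g₀₁ e₁ + g₁₁ e₂`, in the basis of monomials `e₁ ^ b * e₂ ^ (m - b)`
(written here with `e₁ = X`, `e₂ = 1`). -/
def spinMatrix (m : ℕ) (g : SU2) : Matrix (Fin (m + 1)) (Fin (m + 1)) ℂ :=
  fun a b =>
    ((C (g.1 0 0) * X + C (g.1 1 0)) ^ (b : ℕ) *
      (C (g.1 0 1) * X + C (g.1 1 1)) ^ (m - (b : ℕ)) : ℂ[X]).coeff a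

/-- A product of three representation matrix elements, as a function on `SU(2)³`. -/
def matrixCoeff (m : Fin 3 → ℕ) (a b : ∀ i, Fin (m i + 1)) (g : Fin 3 → SU2) : ℂ :=
  ∏ i, spinMatrix (m i) (g i) (a i) (b i)

/-- Complex-valued functions on `SU(2)³` whose Peter-Weyl expansion only involves
spins `j₁, j₂, j₃ ≤ Λ`. -/
def truncatedComplex (Λ : ℝ) : Submodule ℂ ((Fin 3 → SU2) → ℂ) :=
  Submodule.span ℂ {f | ∃ m : Fin 3 → ℕ, (∀ i, (m i : ℝ) / 2 ≤ Λ) ∧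
    ∃ a b : ∀ i, Fin (m i + 1), f = matrixCoeff m a b}

/-- The real vector space `H^(Λ)` of real-valued fields on `SU(2)³` whose Peter-Weyl expansion
only involves spins `j₁, j₂, j₃ ≤ Λ`. -/
def truncated (Λ : ℝ) : Submodule ℝ ((Fin 3 → SU2) → ℝ) :=
  ((truncatedComplex Λ).restrictScalars ℝ).comap
    (Complex.ofRealCLM.toLinearMap.compLeft (Fin 3 → SU2))

/-! ### The covariance -/

/-- The symmetrizer: average over cyclic permutations of the three arguments and over the right
diagonal action of `SU(2)`. -/
def symmetrizer (φ : (Fin 3 → SU2) → ℝ) (g : Fin 3 → SU2) : ℝ :=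
  (1 / 3) * ∑ c : Fin 3, ∫ h : SU2, φ (fun i => g (i + c) * h)

/-- `C` is the integral kernel of the cutoff covariance: it is a kernel on `H^(Λ)` whose associated
integral operator is the restriction of the symmetrizer to `H^(Λ)`. -/
def IsCovarianceKernel (Λ : ℝ) (C : (Fin 3 → SU2) → (Fin 3 → SU2) → ℝ) : Prop :=
  (∀ g, C g ∈ truncated Λ) ∧
    ∀ φ ∈ truncated Λ, ∀ g, ∫ g', C g g' * φ g' = symmetrizer φ g

theorem continuous_spinMatrix (m : ℕ) (a b : Fin (m + 1)) :
    Continuous fun g => spinMatrix m g a b := by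
  have hmul : ∀ p q : SU2 → Polynomial ℂ, (∀ k, Continuous fun g => (p g).coeff k) →
      (∀ k, Continuous fun g => (q g).coeff k) → ∀ k, Continuous fun g => (p g * q g).coeff k := by
    intro p q hp hq k
    simp only [Polynomial.coeff_mul]
    exact continuous_finsetSum _ fun x _ => (hp _).mul (hq _)
  have hpow : ∀ p : SU2 → Polynomial ℂ, (∀ k, Continuous fun g => (p g).coeff k) →
      ∀ n k, Continuous fun g => (p g ^ n).coeff k := by
    intro p hp n
    induction n with
    | zero => intro k; simpa using continuous_const
    | succ n ih => simp only [pow_succ]; exact hmul _ _ ih hp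
  have hent : ∀ i j : Fin 2, Continuous fun g : SU2 => g.1 i j := fun i j =>
    (continuous_apply_apply i j).comp continuous_subtype_val
  have hlin : ∀ i j i' j' : Fin 2, ∀ k, Continuous fun g : SU2 =>
      (Polynomial.C (g.1 i j) * Polynomial.X + Polynomial.C (g.1 i' j')).coeff k := by
    intro i j i' j' k
    simp only [Polynomial.coeff_add, Polynomial.coeff_C_mul, Polynomial.coeff_C]
    refine ((hent _ _).mul continuous_const).add ?_
    split_ifs
    · exact hent _ _
    · exact continuous_const
  exact hmul _ _ (hpow _ (hlin _ _ _ _) _) (hpow _ (hlin _ _ _ _) _) _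

theorem continuous_of_mem_truncated {Λ : ℝ} {φ : (Fin 3 → SU2) → ℝ} (hφ : φ ∈ truncated Λ) :
    Continuous φ := by
  have h : ∀ f ∈ truncatedComplex Λ, Continuous f := by
    intro f hf
    induction hf using Submodule.span_induction with
    | mem f hf =>
      obtain ⟨m, -, a, b, rfl⟩ := hf
      exact continuous_finsetProd _ fun i _ =>
        (continuous_spinMatrix _ _ _).comp (continuous_apply i)
    | zero => exact continuous_const
    | add f g _ _ hf hg => exact hf.add hg
    | smul c f _ hf => exact hf.const_smul c
  have h2 : Continuous fun g => ((φ g : ℝ) : ℂ) := h _ hφ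
  exact Complex.continuous_re.comp h2

instance (Λ : ℝ) : FiniteDimensional ℝ (truncated Λ) := by
  have hfin : {f | ∃ m : Fin 3 → ℕ, (∀ i, (m i : ℝ) / 2 ≤ Λ) ∧
      ∃ a b : ∀ i, Fin (m i + 1), f = matrixCoeff m a b}.Finite := by
    have h1 : (⋃ m ∈ Set.univ.pi fun _ : Fin 3 => Set.Iic ⌊2 * Λ⌋₊,
        Set.range fun p : (∀ i, Fin (m i + 1)) × (∀ i, Fin (m i + 1)) =>
          matrixCoeff m p.1 p.2).Finite :=
      Set.Finite.biUnion (Set.Finite.pi fun _ => Set.finite_Iic _)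
        fun m _ => Set.finite_range _
    refine h1.subset ?_
    rintro f ⟨m, hm, a, b, rfl⟩
    refine Set.mem_biUnion (x := m) ?_ ⟨(a, b), rfl⟩
    intro i _
    exact Nat.le_floor (by have := hm i; linarith)
  have : FiniteDimensional ℂ (truncatedComplex Λ) := FiniteDimensional.span_of_finite ℂ hfin
  have : FiniteDimensional ℝ (truncatedComplex Λ) := FiniteDimensional.complexToReal _
  let T : truncated Λ →ₗ[ℝ] (truncatedComplex Λ).restrictScalars ℝ :=
    (Complex.ofRealCLM.toLinearMap.compLeft (Fin 3 → SU2)).restrict fun _ h => h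
  have : FiniteDimensional ℝ ((truncatedComplex Λ).restrictScalars ℝ) :=
    inferInstanceAs (FiniteDimensional ℝ (truncatedComplex Λ))
  refine FiniteDimensional.of_injective T ?_
  intro x y hxy
  ext g
  have := congrFun (congrArg Subtype.val hxy) g
  exact Complex.ofReal_injective this

theorem integrable_of_continuous {φ : (Fin 3 → SU2) → ℝ} (h : Continuous φ) : Integrable φ :=
  h.integrable_of_hasCompactSupport (HasCompactSupport.of_compactSpace φ)

theorem integrable_mul {Λ : ℝ} (φ ψ : truncated Λ) : Integrable fun g => φ.1 g * ψ.1 g :=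
  integrable_of_continuous
    ((continuous_of_mem_truncated φ.2).mul (continuous_of_mem_truncated ψ.2))

/-- The `L²` pairing on the truncated space. -/
def pairing (Λ : ℝ) : truncated Λ →ₗ[ℝ] truncated Λ →ₗ[ℝ] ℝ :=
  LinearMap.mk₂ ℝ (fun φ ψ => ∫ g, φ.1 g * ψ.1 g)
    (fun φ φ' ψ => by
      simp only [Submodule.coe_add, Pi.add_apply, add_mul]
      exact integral_add (integrable_mul φ ψ) (integrable_mul φ' ψ))
    (fun c φ ψ => by simp [mul_assoc, integral_const_mul])
    (fun φ ψ ψ' => by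
      simp only [Submodule.coe_add, Pi.add_apply, mul_add]
      exact integral_add (integrable_mul φ ψ) (integrable_mul φ ψ'))
    (fun c φ ψ => by simp [mul_left_comm, integral_const_mul])

theorem eq_zero_of_pairing_self {Λ : ℝ} (φ : truncated Λ) (h : pairing Λ φ φ = 0) : φ = 0 := by
  have hc := continuous_of_mem_truncated φ.2
  have h0 : ∫ g, φ.1 g * φ.1 g = 0 := h
  rw [integral_eq_zero_iff_of_nonneg (fun g => mul_self_nonneg _)
    (integrable_of_continuous (hc.mul hc))] at h0
  have h1 := (Continuous.ae_eq_iff_eq volume (hc.mul hc) continuous_const).1 h0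
  ext g
  exact mul_self_eq_zero.1 (congrFun h1 g)

/-- Existence and uniqueness of the kernel of the cutoff covariance. -/
theorem existsUnique_covarianceKernel (Λ : ℝ) : ∃! C, IsCovarianceKernel Λ C := by
  have hinj : Function.Injective (pairing Λ) := by
    rw [injective_iff_map_eq_zero]
    intro φ hφ
    exact eq_zero_of_pairing_self φ (by rw [hφ]; rfl)
  have hsurj : Function.Surjective (pairing Λ) :=
    (LinearMap.injective_iff_surjective_of_finrank_eq_finrank
      Subspace.dual_finrank_eq.symm).1 hinj
  have hsc : ∀ φ : truncated Λ, ∀ (g : Fin 3 → SU2) (c : Fin 3),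
      Integrable fun h : SU2 => φ.1 (fun i => g (i + c) * h) := by
    intro φ g c
    have : Continuous fun h : SU2 => φ.1 (fun i => g (i + c) * h) :=
      (continuous_of_mem_truncated φ.2).comp (by fun_prop)
    exact this.integrable_of_hasCompactSupport (HasCompactSupport.of_compactSpace _)
  let ev : (Fin 3 → SU2) → Module.Dual ℝ (truncated Λ) := fun g =>
    { toFun := fun φ => symmetrizer φ.1 g
      map_add' := by
        intro φ ψ
        simp only [symmetrizer, Submodule.coe_add, Pi.add_apply]
        rw [← mul_add, ← Finset.sum_add_distrib]
        congr 1
        exact Finset.sum_congr rfl fun c _ => integral_add (hsc φ g c) (hsc ψ g c)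
      map_smul' := by
        intro r φ
        simp only [symmetrizer, Submodule.coe_smul, Pi.smul_apply, smul_eq_mul, RingHom.id_apply,
          integral_const_mul, ← Finset.mul_sum]
        ring }
  choose k hk using fun g => hsurj (ev g)
  refine ⟨fun g => (k g).1, ⟨fun g => (k g).2, fun φ hφ g => ?_⟩, ?_⟩
  · exact LinearMap.congr_fun (hk g) ⟨φ, hφ⟩
  · rintro C ⟨hC1, hC2⟩
    funext g
    have : (⟨C g, hC1 g⟩ : truncated Λ) = k g := by
      refine hinj (LinearMap.ext fun φ => ?_)
      rw [hk g]
      exact hC2 φ.1 φ.2 g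
    exact congrArg Subtype.val this

/-- The integral kernel `C^(Λ)(g; g')` of the cutoff covariance, i.e. of the orthogonal projector
of `H^(Λ)` onto its subspace of fields invariant under cyclic permutations of the arguments and
under the right diagonal action of `SU(2)`. -/
def covarianceKernel (Λ : ℝ) : (Fin 3 → SU2) → (Fin 3 → SU2) → ℝ :=
  (existsUnique_covarianceKernel Λ).choose

theorem covarianceKernel_spec (Λ : ℝ) : IsCovarianceKernel Λ (covarianceKernel Λ) :=
  (existsUnique_covarianceKernel Λ).choose_spec.1

/-! ### Vertices, vacuum graphs and amplitudes -/

/-- The two types of vertices. -/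
inductive VertexType
  | tetrahedron
  | pillow

/-- Arguments of the four fields in the quartic interactions: `slot t k i` is the index, among the
six group variables, of the `i`-th argument of the `k`-th field. With variables `g₁, …, g₆`:
tetrahedron `φ(g₁,g₂,g₃) φ(g₃,g₄,g₅) φ(g₅,g₂,g₆) φ(g₆,g₄,g₁)`,
pillow `φ(g₁,g₂,g₃) φ(g₃,g₄,g₅) φ(g₅,g₄,g₆) φ(g₆,g₂,g₁)`. -/
def slot : VertexType → Fin 4 → Fin 3 → Fin 6
  | .tetrahedron => ![![0, 1, 2], ![2, 3, 4], ![4, 1, 5], ![5, 3, 0]]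
  | .pillow => ![![0, 1, 2], ![2, 3, 4], ![4, 3, 5], ![5, 1, 0]]

/-- The factor attached to a vertex in the expansion of `exp (-(lam / 8) * (P + δ T))` in powers of
the coupling constant `lam` (which is itself stripped off). -/
def vertexWeight (δ : ℝ) : VertexType → ℝ
  | .tetrahedron => -δ / 8
  | .pillow => -1 / 8

/-- A vacuum Feynman graph of the model with set of vertices `V` and set of lines `L`: each vertex
is a tetrahedron or a pillow with four labelled fields, and the lines contract all the fields in
pairs. (The listing of the two ends of each line is immaterial: the covariance is symmetric.) -/
structure VacuumGraph (V L : Type) where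
  /-- the type of each vertex -/
  type : V → VertexType
  /-- the two fields contracted by each line -/
  ends : L × Fin 2 ≃ V × Fin 4

namespace VacuumGraph

variable {V L : Type}

/-- The graph is connected (in particular it has at least one vertex). -/
def Connected (G : VacuumGraph V L) : Prop :=
  (SimpleGraph.fromRel fun v w : V =>
    ∃ l : L, (G.ends (l, 0)).1 = v ∧ (G.ends (l, 1)).1 = w).Connected

/-- The arguments of a field `e = (v, k)`, given the six group variables at every vertex. -/
def fieldArgs (G : VacuumGraph V L) (x : V → Fin 6 → SU2) (e : V × Fin 4) : Fin 3 → SU2 :=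
  fun i => x e.1 (slot (G.type e.1) e.2 i)

/-- The Feynman amplitude (coefficient of the coupling constant to the power the order of the
graph): product of the vertex factors, times the integral over the six group variables of each
vertex of the product of the cutoff covariances of the lines. -/
def amplitude [Fintype V] [Fintype L] (δ Λ : ℝ) (G : VacuumGraph V L) : ℝ :=
  (∏ v, vertexWeight δ (G.type v)) *
    ∫ x : V → Fin 6 → SU2,
      ∏ l : L, covarianceKernel Λ (G.fieldArgs x (G.ends (l, 0))) (G.fieldArgs x (G.ends (l, 1)))

end VacuumGraph

end BFL

end

/-!
Let `κ` be the reproducing kernel of the space of functions on `SU(2)` of spin at most `Λ`. The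
integral operator of `κ` is an orthogonal projector, and `∫ κ(x, y)² dx` is the dimension of the
space, at most `N = O(Λ³)`. The covariance is the average, over the three cyclic permutations and
over `h`, of `κ(g₁h, g'₁) κ(g₂h, g'₂) κ(g₃h, g'₃)` (`covarianceKernel_eq`). Inserting a point in the
middle of every line, with an average over the right diagonal action on either side
(`integral_prod_kernel_eq`), writes the amplitude as an average over the choices of cyclic
permutations of integrals of a product of kernels, one for each field of the graph
(`VacuumGraph.amplitude_eq`).

Such an integral is estimated by reading the fields in some order. The kernel of a field `e` is then
an operator from `L²` of the variables already met to `L²` of the variables still to come, and the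
integral is at most the product of the norms of these operators (`sq_integral_prod_le`). If the
line of `e` leads to a later field, then the strands of `e` whose vertex variables were met before
are contractions, and the `r` other strands are partial traces, which cost `√N` each; but the
average over `h` turns one of these into a contraction as well, so that the norm is at most
`N ^ ((r - 1) / 2)` (`StrandKernel.sq_integral_mul_prod_le`; here `0 - 1 = 0`). If the line leads to
an earlier field, then by duality `r` counts the strands whose vertex variables were met before.

Suppose that the first field of a vertex is contracted with an earlier field and the last one with a
later field. Then these two fields are free, since the variables of the first are all new and those
of the last all old. If the second field shares a variable with the first, then the second and the
third have both new and old variables, so that each costs at most `√N`. Hence a vertex costs `N`.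
An order of this kind exists for every connected graph, up to one vertex where the reading starts
and one where it stops, which cost an additional `N` each (`exists_transferOrder`): remove a vertex,
join the four lines that end there in two pairs so that the graph remains connected, order the
smaller graph, and insert the fields of the removed vertex between or after the ends of the new
lines. The choice of the pairs is restricted by the pillow, whose opposite fields have no variable
in common and so must not come first and second.

The total is `N ^ (n + 2)` for `n` vertices, that is `Λ ^ (6 + 3 n)` up to a constant to the power
`n`.
-/

namespace BFL

/-! ### Invariance of the Haar measure, and the Cauchy-Schwarz inequality -/

instance : (volume : Measure SU2).IsMulRightInvariant where
  map_mul_right_eq_self g := by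
    have : IsProbabilityMeasure (Measure.map (· * g) (volume : Measure SU2)) :=
      Measure.isProbabilityMeasure_map (measurable_mul_const g).aemeasurable
    exact Measure.isHaarMeasure_eq_of_isProbabilityMeasure _ _

instance : (volume : Measure SU2).IsInvInvariant where
  inv_eq_self := by
    have : IsProbabilityMeasure (volume : Measure SU2).inv :=
      Measure.isProbabilityMeasure_map measurable_inv.aemeasurable
    have : (volume : Measure SU2).inv.IsHaarMeasure := { }
    exact Measure.isHaarMeasure_eq_of_isProbabilityMeasure _ _

theorem integrable_of_compact {X E : Type*} [TopologicalSpace X] [CompactSpace X]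
    [MeasurableSpace X] [OpensMeasurableSpace X] {μ : Measure X} [IsFiniteMeasure μ]
    [NormedAddCommGroup E] [SecondCountableTopologyEither X E] {f : X → E} (hf : Continuous f) :
    Integrable f μ :=
  hf.integrable_of_hasCompactSupport (HasCompactSupport.of_compactSpace f)

theorem sq_integral_mul_le {X : Type*} [TopologicalSpace X] [CompactSpace X]
    [MeasurableSpace X] [OpensMeasurableSpace X] {μ : Measure X} [IsFiniteMeasure μ]
    {f g : X → ℝ} (hf : Continuous f) (hg : Continuous g) :
    (∫ x, f x * g x ∂μ) ^ 2 ≤ (∫ x, f x ^ 2 ∂μ) * ∫ x, g x ^ 2 ∂μ := by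
  have h := discrim_le_zero (a := ∫ x, g x ^ 2 ∂μ) (b := 2 * ∫ x, f x * g x ∂μ)
    (c := ∫ x, f x ^ 2 ∂μ) fun t => by
      have : (∫ x, (f x + t * g x) ^ 2 ∂μ) = (∫ x, g x ^ 2 ∂μ) * (t * t) +
          2 * (∫ x, f x * g x ∂μ) * t + ∫ x, f x ^ 2 ∂μ := by
        have h1 : ∀ x, (f x + t * g x) ^ 2 =
            (t * t) * g x ^ 2 + (2 * t) * (f x * g x) + f x ^ 2 := fun x => by ring
        simp_rw [h1]
        rw [integral_add, integral_add, integral_const_mul, integral_const_mul]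
        · ring
        all_goals exact integrable_of_compact (by fun_prop)
      rw [← this]
      exact integral_nonneg fun x => sq_nonneg _
  rw [discrim] at h
  nlinarith

/-! ### Integration over single coordinates of a finite power of `SU(2)` -/

section Coordinates

variable {ι : Type*} [DecidableEq ι]

/-- The function `f` does not depend on the coordinate `i`. -/
def Ignores (f : (ι → SU2) → ℝ) (i : ι) : Prop :=
  ∀ ω x, f (Function.update ω i x) = f ω

/-- Integration over the coordinate `i` only, as a function of the other coordinates. -/
noncomputable def coordIntegral (i : ι) (f : (ι → SU2) → ℝ) (ω : ι → SU2) : ℝ :=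
  ∫ x, f (Function.update ω i x)

theorem Ignores.mul {f g : (ι → SU2) → ℝ} {i : ι} (hf : Ignores f i) (hg : Ignores g i) :
    Ignores (fun ω => f ω * g ω) i := fun ω x => by simp only [hf ω x, hg ω x]

theorem Ignores.prod {α : Type*} {s : Finset α} {f : α → (ι → SU2) → ℝ} {i : ι}
    (hf : ∀ a ∈ s, Ignores (f a) i) : Ignores (fun ω => ∏ a ∈ s, f a ω) i :=
  fun ω x => Finset.prod_congr rfl fun a ha => hf a ha ω x

theorem Ignores.coordIntegral {f : (ι → SU2) → ℝ} {i j : ι} (hf : Ignores f j) :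
    Ignores (coordIntegral i f) j := by
  intro ω x
  unfold BFL.coordIntegral
  by_cases h : i = j
  · subst h
    simp
  · simp_rw [Function.update_comm (Ne.symm h)]
    simp [hf _ x]

theorem ignores_coordIntegral (f : (ι → SU2) → ℝ) (i : ι) : Ignores (coordIntegral i f) i := by
  intro ω x
  simp [coordIntegral]

theorem coordIntegral_mul {f g : (ι → SU2) → ℝ} {i : ι} (hg : Ignores g i) (ω : ι → SU2) :
    coordIntegral i (fun ω => f ω * g ω) ω = coordIntegral i f ω * g ω := by
  unfold coordIntegral
  simp_rw [hg ω]
  rw [integral_mul_const]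

variable [Fintype ι]

theorem continuous_coordIntegral {f : (ι → SU2) → ℝ} (hf : Continuous f) (i : ι) :
    Continuous (coordIntegral i f) := by
  have := continuous_parametric_integral_of_continuous (μ := (volume : Measure SU2))
    (f := fun (ω : ι → SU2) x => f (Function.update ω i x))
    (hf.comp (continuous_fst.update i continuous_snd)) isCompact_univ
  rw [Measure.restrict_univ] at this
  exact this

theorem measurePreserving_update (i : ι) :
    MeasurePreserving (fun p : (ι → SU2) × SU2 => Function.update p.1 i p.2) := by
  have hm : Measurable (fun p : (ι → SU2) × SU2 => Function.update p.1 i p.2) :=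
    (continuous_fst.update i continuous_snd).measurable
  refine ⟨hm, (Measure.pi_eq fun s hs => ?_).symm⟩
  rw [Measure.map_apply hm (MeasurableSet.univ_pi hs)]
  have : (fun p : (ι → SU2) × SU2 => Function.update p.1 i p.2) ⁻¹' Set.univ.pi s =
      (Set.univ.pi (Function.update s i Set.univ)) ×ˢ (s i) := by
    ext ⟨ω, x⟩
    simp only [Set.mem_preimage, Set.mem_univ_pi, Set.mem_prod]
    constructor
    · intro h
      refine ⟨fun j => ?_, by simpa using h i⟩
      by_cases hj : j = i
      · subst hj; simp
      · simpa [hj] using h j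
    · rintro ⟨h1, h2⟩ j
      by_cases hj : j = i
      · subst hj; simpa using h2
      · simpa [hj] using h1 j
  rw [this]
  change (volume.prod volume) _ = _
  rw [Measure.prod_prod, volume_pi, Measure.pi_pi, ← Finset.mul_prod_erase _ _ (Finset.mem_univ i),
    ← Finset.mul_prod_erase _ (fun j => volume (s j)) (Finset.mem_univ i)]
  simp only [Function.update_self, measure_univ, one_mul]
  rw [mul_comm]
  congr 1
  exact Finset.prod_congr rfl fun j hj => by rw [Function.update_of_ne (Finset.ne_of_mem_erase hj)]

theorem integral_coordIntegral {f : (ι → SU2) → ℝ} (hf : Continuous f) (i : ι) :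
    ∫ ω, coordIntegral i f ω = ∫ ω, f ω := by
  have hc : Continuous fun p : (ι → SU2) × SU2 => f (Function.update p.1 i p.2) :=
    hf.comp (continuous_fst.update i continuous_snd)
  have h := integral_map (measurePreserving_update i).measurable.aemeasurable
    (μ := volume) hf.aestronglyMeasurable
  rw [(measurePreserving_update i).map_eq] at h
  rw [h]
  exact (integral_prod _ (integrable_of_compact (μ := volume.prod volume) hc)).symm

theorem integral_mul_of_ignores {f g : (ι → SU2) → ℝ} (hf : Continuous f) (hg : Continuous g)
    {i : ι} (hi : Ignores g i) : ∫ ω, f ω * g ω = ∫ ω, coordIntegral i f ω * g ω := by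
  rw [← integral_coordIntegral (f := fun ω => f ω * g ω) (hf.mul hg) i]
  exact integral_congr_ae (.of_forall fun ω => coordIntegral_mul hi ω)

/-- Integrating out a set `s` of coordinates, in the weak form that is needed: the resulting
function is characterized by its integrals against functions which do not depend on `s`. -/
theorem exists_marginal {f : (ι → SU2) → ℝ} (hf : Continuous f) (s : Finset ι) :
    ∃ f' : (ι → SU2) → ℝ, Continuous f' ∧ (∀ i ∈ s, Ignores f' i) ∧
      (∀ j, Ignores f j → Ignores f' j) ∧
      ∀ g : (ι → SU2) → ℝ, Continuous g → (∀ i ∈ s, Ignores g i) →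
        ∫ ω, f ω * g ω = ∫ ω, f' ω * g ω := by
  induction s using Finset.induction_on with
  | empty => exact ⟨f, hf, by simp, fun _ h => h, fun _ _ _ => rfl⟩
  | insert i s _ ih =>
    obtain ⟨f', hc, hs, hj, hg⟩ := ih
    refine ⟨coordIntegral i f', continuous_coordIntegral hc i, fun j hj' => ?_,
      fun j h => (hj j h).coordIntegral, fun g hgc hgi => ?_⟩
    · rcases Finset.mem_insert.1 hj' with rfl | h
      · exact ignores_coordIntegral _ _
      · exact (hs j h).coordIntegral
    · rw [hg g hgc fun k hk => hgi k (Finset.mem_insert_of_mem hk)]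
      exact integral_mul_of_ignores hc hgc (hgi i (Finset.mem_insert_self _ _))

/-! ### Transfer of norms along an ordered product of kernels -/

/-- Bound on the integral of a product of kernels `K e`, ordered by `pos`, where `K e` only depends
on the coordinates in `touch e`. The kernel `K e` maps functions of the coordinates touched before
`e` to functions of the coordinates touched after `e`; if the square of its norm as an operator
between `L²` spaces is at most `w e`, then the integral of the product is bounded by the product of
these norms. -/
theorem sq_integral_prod_le {E : Type*} [DecidableEq E] (pos : E → ℚ)
    (hpos : Function.Injective pos)
    (touch : E → Finset ι) (K : E → (ι → SU2) → ℝ) (hK : ∀ e, Continuous (K e))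
    (htouch : ∀ e, ∀ i ∉ touch e, Ignores (K e) i) (w : E → ℝ)
    (hw : ∀ e, 0 ≤ w e)
    (hloc : ∀ e, ∀ f b : (ι → SU2) → ℝ, Continuous f → Continuous b →
      (∀ i, (∀ e', pos e' < pos e → i ∉ touch e') → Ignores f i) →
      (∀ i ∈ touch e, (∀ e', pos e < pos e' → i ∉ touch e') → Ignores b i) →
      (∫ ω, f ω * b ω * K e ω) ^ 2 ≤ w e * ((∫ ω, f ω ^ 2) * ∫ ω, b ω ^ 2))
    (S : Finset E) :
    (∀ e ∈ S, ∀ e' ∉ S, pos e' < pos e) →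
    ∀ f : (ι → SU2) → ℝ, Continuous f →
      (∀ i, (∀ e' ∉ S, i ∉ touch e') → Ignores f i) →
      (∫ ω, f ω * ∏ e ∈ S, K e ω) ^ 2 ≤ (∏ e ∈ S, w e) * ∫ ω, f ω ^ 2 := by
  induction S using Finset.induction_on_min_value pos with
  | empty =>
    intro _ f hf _
    simpa using sq_integral_mul_le (μ := volume) hf (continuous_const (y := (1 : ℝ)))
  | insert e S he hmin ih =>
    intro hup f hf hfi
    have hlt : ∀ e' ∈ S, pos e < pos e' := fun e' he' =>
      lt_of_le_of_ne (hmin e' he') fun h => he (hpos h ▸ he')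
    classical
    let D := (touch e).filter fun i => ∀ e', pos e < pos e' → i ∉ touch e'
    have hD : ∀ i, i ∈ D ↔ i ∈ touch e ∧ ∀ e', pos e < pos e' → i ∉ touch e' := fun i => by
      simp [D]
    obtain ⟨f', hf', hf'D, hf'i, hint⟩ :=
      exists_marginal (f := fun ω => f ω * K e ω) (hf.mul (hK e)) D
    have hf'2 : ∫ ω, f' ω ^ 2 ≤ w e * ∫ ω, f ω ^ 2 := by
      have h1 := hloc e f f' hf hf' (fun i hi => hfi i fun e' he' => hi e' ?_)
        (fun i hi hi' => hf'D i ((hD i).2 ⟨hi, hi'⟩))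
      · have h2 : ∫ ω, f ω * f' ω * K e ω = ∫ ω, f' ω ^ 2 := by
          simp_rw [pow_two]
          rw [← hint f' hf' hf'D]
          exact integral_congr_ae (.of_forall fun ω => by ring)
        rw [h2] at h1
        have h0 : 0 ≤ ∫ ω, f' ω ^ 2 := integral_nonneg fun ω => sq_nonneg _
        rcases h0.eq_or_lt with h0 | h0
        · rw [← h0]
          exact mul_nonneg (hw e) (integral_nonneg fun ω => sq_nonneg _)
        · refine le_of_mul_le_mul_right ?_ h0
          linarith
      · exact hup e (Finset.mem_insert_self _ _) e' he'
    have hup' : ∀ e₁ ∈ S, ∀ e' ∉ S, pos e' < pos e₁ := by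
      intro e₁ h1 e' h2
      by_cases h : e' = e
      · exact h ▸ hlt e₁ h1
      · exact hup e₁ (Finset.mem_insert_of_mem h1) e' (by simp [h, h2])
    have h3 := ih hup' f' hf' fun i hi => by
      refine hf'i i (Ignores.mul (hfi i fun e' he' => hi e' fun h => he' ?_) (htouch e i (hi e he)))
      exact Finset.mem_insert_of_mem h
    have h4 : ∫ ω, f ω * ∏ e ∈ insert e S, K e ω = ∫ ω, f' ω * ∏ e ∈ S, K e ω := by
      rw [← hint _ (continuous_finsetProd _ fun e _ => hK e)]
      · simp_rw [Finset.prod_insert he, mul_assoc]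
      · exact fun i hi => Ignores.prod fun e' he' => htouch e' i (((hD i).1 hi).2 e' (hlt e' he'))
    rw [h4, Finset.prod_insert he]
    calc _ ≤ _ := h3
      _ ≤ (∏ e ∈ S, w e) * (w e * ∫ ω, f ω ^ 2) :=
        mul_le_mul_of_nonneg_left hf'2 (Finset.prod_nonneg fun e _ => hw e)
      _ = _ := by ring

end Coordinates

/-! ### Norm of the operator attached to one end of a line -/

/-- The properties of the reproducing kernel of the truncated space of functions on `SU(2)` that
control the amplitudes: `N` bounds the dimension of the space, and the associated integral operator
is a projector, in particular a contraction of `L²`. -/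
structure StrandKernel (N : ℝ) (κ : SU2 → SU2 → ℝ) : Prop where
  cont : Continuous fun p : SU2 × SU2 => κ p.1 p.2
  mul_right : ∀ x y h, κ (x * h) (y * h) = κ x y
  sq_le : ∀ y, ∫ x, κ x y ^ 2 ≤ N
  contraction : ∀ β : SU2 → ℝ, Continuous β → ∫ y, (∫ x, β x * κ x y) ^ 2 ≤ ∫ x, β x ^ 2

theorem integral_mul_inv_right (F : SU2 → ℝ) (z : SU2) : ∫ h, F (z * h⁻¹) = ∫ h, F h := by
  rw [integral_inv_eq_self (fun h => F (z * h))]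
  exact integral_mul_left_eq_self F z

section Strand

variable {N : ℝ} {κ : SU2 → SU2 → ℝ} {ι : Type*}

/-- The factor of one strand: it joins the coordinates `a` and `c`, the coordinate `h` being the
group element of the averaging over the right diagonal action. -/
def strand (κ : SU2 → SU2 → ℝ) (a h c : ι) (ω : ι → SU2) : ℝ := κ (ω a * ω h) (ω c)

theorem StrandKernel.continuous_strand (hκ : StrandKernel N κ) (a h c : ι) :
    Continuous (strand κ a h c) := by
  have h1 : Continuous fun ω : ι → SU2 => (ω a * ω h, ω c) := by fun_prop
  exact hκ.cont.comp h1

variable [DecidableEq ι]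

theorem ignores_strand {a h c i : ι} (ha : i ≠ a) (hh : i ≠ h) (hc : i ≠ c) :
    Ignores (strand κ a h c) i := by
  intro ω x
  simp [strand, ha.symm, hh.symm, hc.symm]

theorem continuous_update_right (ω : ι → SU2) (i : ι) {f : (ι → SU2) → ℝ} (hf : Continuous f) :
    Continuous fun x => f (Function.update ω i x) :=
  hf.comp (continuous_const.update i continuous_id)

variable [Fintype ι]

/-- Integrating a function against a strand is a contraction, if the far end `c` of the strand is a
new coordinate. -/
theorem StrandKernel.integral_sq_le_of_ignores_end (hκ : StrandKernel N κ) {a h c : ι}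
    (hah : a ≠ h) (hac : a ≠ c) (hhc : h ≠ c) {f : (ι → SU2) → ℝ} (hf : Continuous f)
    (hc : Ignores f c) :
    ∫ ω, coordIntegral a (fun ω => f ω * strand κ a h c ω) ω ^ 2 ≤ ∫ ω, f ω ^ 2 := by
  have hF : Continuous fun ω => f ω * strand κ a h c ω := hf.mul (hκ.continuous_strand a h c)
  have hf2 : Continuous fun ω => f ω ^ 2 := hf.pow 2
  have hF2 : Continuous fun ω => coordIntegral a (fun ω => f ω * strand κ a h c ω) ω ^ 2 :=
    (continuous_coordIntegral hF a).pow 2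
  rw [← integral_coordIntegral hF2 c,
    ← integral_coordIntegral hf2 a]
  refine integral_mono (integrable_of_compact
    (continuous_coordIntegral hF2 c))
    (integrable_of_compact (continuous_coordIntegral hf2 a)) fun ω => ?_
  have hβ := continuous_update_right ω a hf
  have h1 : coordIntegral c (fun ω => coordIntegral a (fun ω => f ω * strand κ a h c ω) ω ^ 2) ω =
      ∫ y, (∫ x, f (Function.update ω a (x * (ω h)⁻¹)) * κ x y) ^ 2 := by
    unfold coordIntegral
    refine integral_congr_ae (.of_forall fun y => ?_)
    dsimp only
    congr 1
    rw [← integral_mul_right_eq_self (fun x => _ * κ x y) (ω h)]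
    refine integral_congr_ae (.of_forall fun x => ?_)
    dsimp only [strand]
    rw [Function.update_comm hac.symm, hc]
    simp [hah.symm, hac, hhc]
  calc _ = _ := h1
    _ ≤ _ := hκ.contraction _ (hβ.comp (continuous_mul_const (ω h)⁻¹))
    _ = _ := integral_mul_right_eq_self (fun x => f (Function.update ω a x) ^ 2) (ω h)⁻¹

/-- Integrating a function against a strand is a contraction, if the function does not depend on the
group element `h` of the averaging. -/
theorem StrandKernel.integral_sq_le_of_ignores_mid (hκ : StrandKernel N κ) {a h c : ι}
    (hah : a ≠ h) (hac : a ≠ c) (hhc : h ≠ c) {f : (ι → SU2) → ℝ} (hf : Continuous f)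
    (hh : Ignores f h) :
    ∫ ω, coordIntegral a (fun ω => f ω * strand κ a h c ω) ω ^ 2 ≤ ∫ ω, f ω ^ 2 := by
  have hF : Continuous fun ω => f ω * strand κ a h c ω := hf.mul (hκ.continuous_strand a h c)
  have hf2 : Continuous fun ω => f ω ^ 2 := hf.pow 2
  have hF2 : Continuous fun ω => coordIntegral a (fun ω => f ω * strand κ a h c ω) ω ^ 2 :=
    (continuous_coordIntegral hF a).pow 2
  rw [← integral_coordIntegral hF2 h,
    ← integral_coordIntegral hf2 a]
  refine integral_mono (integrable_of_compact
    (continuous_coordIntegral hF2 h))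
    (integrable_of_compact (continuous_coordIntegral hf2 a)) fun ω => ?_
  have hβ := continuous_update_right ω a hf
  have h1 : coordIntegral h (fun ω => coordIntegral a (fun ω => f ω * strand κ a h c ω) ω ^ 2) ω =
      ∫ y, (∫ x, f (Function.update ω a x) * κ x y) ^ 2 := by
    rw [← integral_mul_inv_right _ (ω c)]
    unfold coordIntegral
    refine integral_congr_ae (.of_forall fun y => ?_)
    dsimp only
    congr 1
    refine integral_congr_ae (.of_forall fun x => ?_)
    dsimp only [strand]
    rw [Function.update_comm hah.symm, hh, ← hκ.mul_right x _ y]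
    simp [hah, hac.symm, hhc.symm]
  exact h1.trans_le (hκ.contraction _ hβ)

/-- Integrating a function against a strand multiplies the `L²` norm by at most `√N`. -/
theorem StrandKernel.integral_sq_le (hκ : StrandKernel N κ) {a h c : ι}
    (hah : a ≠ h) (hac : a ≠ c) {f : (ι → SU2) → ℝ} (hf : Continuous f) :
    ∫ ω, coordIntegral a (fun ω => f ω * strand κ a h c ω) ω ^ 2 ≤ N * ∫ ω, f ω ^ 2 := by
  have hF : Continuous fun ω => f ω * strand κ a h c ω := hf.mul (hκ.continuous_strand a h c)
  have hf2 : Continuous fun ω => f ω ^ 2 := hf.pow 2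
  have hF2 : Continuous fun ω => coordIntegral a (fun ω => f ω * strand κ a h c ω) ω ^ 2 :=
    (continuous_coordIntegral hF a).pow 2
  rw [← integral_coordIntegral hf2 a, ← integral_const_mul]
  refine integral_mono (integrable_of_compact hF2)
    ((integrable_of_compact (continuous_coordIntegral hf2 a)).const_mul N) fun ω => ?_
  have hβ := continuous_update_right ω a hf
  have hg := continuous_update_right ω a (hκ.continuous_strand a h c)
  have h1 := sq_integral_mul_le (μ := volume) hβ hg
  have h2 : ∫ x, strand κ a h c (Function.update ω a x) ^ 2 ≤ N := by
    refine le_trans (le_of_eq ?_) (hκ.sq_le (ω c))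
    rw [← integral_mul_right_eq_self (fun x => κ x (ω c) ^ 2) (ω h)]
    refine integral_congr_ae (.of_forall fun x => ?_)
    simp [strand, hah.symm, hac.symm]
  refine h1.trans ?_
  rw [mul_comm]
  exact mul_le_mul_of_nonneg_right h2 (integral_nonneg fun x => sq_nonneg _)

variable {α : Type*} [DecidableEq α] {ξ ζ : α → ι} {η : ι}

/-- Integrating out the near ends of a set of strands whose far ends are new coordinates. -/
theorem StrandKernel.exists_integral_out (hκ : StrandKernel N κ)
    (hξ : Function.Injective ξ) (hζ : Function.Injective ζ) (hξζ : ∀ i j, ξ i ≠ ζ j)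
    (hξη : ∀ i, ξ i ≠ η) (hζη : ∀ i, η ≠ ζ i) {f : (ι → SU2) → ℝ} (hf : Continuous f)
    (S : Finset α) (hfζ : ∀ i ∈ S, Ignores f (ζ i)) :
    ∃ f' : (ι → SU2) → ℝ, Continuous f' ∧ (∀ i ∈ S, Ignores f' (ξ i)) ∧
      (∀ j, j ≠ η → (∀ i ∈ S, j ≠ ζ i) → Ignores f j → Ignores f' j) ∧
      ∫ ω, f' ω ^ 2 ≤ ∫ ω, f ω ^ 2 ∧
      ∀ g : (ι → SU2) → ℝ, Continuous g → (∀ i ∈ S, Ignores g (ξ i)) →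
        ∫ ω, f ω * (∏ i ∈ S, strand κ (ξ i) η (ζ i) ω) * g ω = ∫ ω, f' ω * g ω := by
  induction S using Finset.induction_on with
  | empty => exact ⟨f, hf, by simp, fun _ _ _ h => h, le_rfl, fun g _ _ => by simp⟩
  | insert a S ha ih =>
    obtain ⟨f', hc, hS, hj, hle, hg⟩ := ih fun i hi => hfζ i (Finset.mem_insert_of_mem hi)
    have hs := fun i => hκ.continuous_strand (ξ i) η (ζ i)
    have hF : Continuous fun ω => f' ω * strand κ (ξ a) η (ζ a) ω := hc.mul (hs a)
    have hζS : ∀ i ∈ S, ζ a ≠ ζ i := fun i hi h => ha (hζ h ▸ hi)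
    refine ⟨coordIntegral (ξ a) fun ω => f' ω * strand κ (ξ a) η (ζ a) ω,
      continuous_coordIntegral hF _, fun i hi => ?_, fun j hjη hjζ hfj => ?_, ?_,
      fun g hgc hgi => ?_⟩
    · rcases Finset.mem_insert.1 hi with rfl | hi'
      · exact ignores_coordIntegral _ _
      · exact ((hS i hi').mul (ignores_strand (hξ.ne (ne_of_mem_of_not_mem hi' ha)) (hξη i)
          (hξζ i a))).coordIntegral
    · by_cases hja : j = ξ a
      · exact hja ▸ ignores_coordIntegral _ _
      · exact ((hj j hjη (fun i hi => hjζ i (Finset.mem_insert_of_mem hi)) hfj).mul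
          (ignores_strand hja hjη (hjζ a (Finset.mem_insert_self _ _)))).coordIntegral
    · refine (hκ.integral_sq_le_of_ignores_end (hξη a) (hξζ a a) (hζη a) hc ?_).trans hle
      exact hj _ (hζη a).symm hζS (hfζ a (Finset.mem_insert_self _ _))
    · have h1 := hg (fun ω => strand κ (ξ a) η (ζ a) ω * g ω) ((hs a).mul hgc) fun i hi =>
        (ignores_strand (hξ.ne (ne_of_mem_of_not_mem hi ha)) (hξη i) (hξζ i a)).mul
          (hgi i (Finset.mem_insert_of_mem hi))
      rw [← integral_mul_of_ignores hF hgc (hgi a (Finset.mem_insert_self _ _))]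
      simp_rw [mul_assoc]
      rw [← h1]
      refine integral_congr_ae (.of_forall fun ω => ?_)
      dsimp only
      rw [Finset.prod_insert ha]
      ring

/-- Integrating out the near ends of a set of strands, with a factor `N` for each. -/
theorem StrandKernel.exists_integral_trace (hκ : StrandKernel N κ) (hN : 0 ≤ N)
    (hξ : Function.Injective ξ) (hξζ : ∀ i j, ξ i ≠ ζ j)
    (hξη : ∀ i, ξ i ≠ η) {f : (ι → SU2) → ℝ} (hf : Continuous f) (S : Finset α) :
    ∃ f' : (ι → SU2) → ℝ, Continuous f' ∧
      ∫ ω, f' ω ^ 2 ≤ N ^ S.card * ∫ ω, f ω ^ 2 ∧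
      ∀ g : (ι → SU2) → ℝ, Continuous g → (∀ i ∈ S, Ignores g (ξ i)) →
        ∫ ω, f ω * (∏ i ∈ S, strand κ (ξ i) η (ζ i) ω) * g ω = ∫ ω, f' ω * g ω := by
  induction S using Finset.induction_on with
  | empty => exact ⟨f, hf, by simp, fun g _ _ => by simp⟩
  | insert a S ha ih =>
    obtain ⟨f', hc, hle, hg⟩ := ih
    have hs := fun i => hκ.continuous_strand (ξ i) η (ζ i)
    have hF : Continuous fun ω => f' ω * strand κ (ξ a) η (ζ a) ω := hc.mul (hs a)
    refine ⟨coordIntegral (ξ a) fun ω => f' ω * strand κ (ξ a) η (ζ a) ω,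
      continuous_coordIntegral hF _, ?_, fun g hgc hgi => ?_⟩
    · refine (hκ.integral_sq_le (hξη a) (hξζ a a) hc).trans ?_
      rw [Finset.card_insert_of_notMem ha, pow_succ', mul_assoc]
      exact mul_le_mul_of_nonneg_left hle hN
    · have h1 := hg (fun ω => strand κ (ξ a) η (ζ a) ω * g ω) ((hs a).mul hgc) fun i hi =>
        (ignores_strand (hξ.ne (ne_of_mem_of_not_mem hi ha)) (hξη i) (hξζ i a)).mul
          (hgi i (Finset.mem_insert_of_mem hi))
      rw [← integral_mul_of_ignores hF hgc (hgi a (Finset.mem_insert_self _ _))]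
      simp_rw [mul_assoc]
      rw [← h1]
      refine integral_congr_ae (.of_forall fun ω => ?_)
      dsimp only
      rw [Finset.prod_insert ha]
      ring

/-- Integrating out the near ends of a set of strands which share the group element `η` of the
averaging: this averaging saves one factor `N`. -/
theorem StrandKernel.exists_integral_in (hκ : StrandKernel N κ) (hN : 0 ≤ N)
    (hξ : Function.Injective ξ) (hξζ : ∀ i j, ξ i ≠ ζ j)
    (hξη : ∀ i, ξ i ≠ η) (hζη : ∀ i, η ≠ ζ i) {f : (ι → SU2) → ℝ} (hf : Continuous f)
    (hfη : Ignores f η) (S : Finset α) :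
    ∃ f' : (ι → SU2) → ℝ, Continuous f' ∧
      ∫ ω, f' ω ^ 2 ≤ N ^ (S.card - 1) * ∫ ω, f ω ^ 2 ∧
      ∀ g : (ι → SU2) → ℝ, Continuous g → (∀ i ∈ S, Ignores g (ξ i)) →
        ∫ ω, f ω * (∏ i ∈ S, strand κ (ξ i) η (ζ i) ω) * g ω = ∫ ω, f' ω * g ω := by
  rcases S.eq_empty_or_nonempty with rfl | ⟨a, haS⟩
  · exact ⟨f, hf, by simp, fun g _ _ => by simp⟩
  have hs := fun i => hκ.continuous_strand (ξ i) η (ζ i)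
  have hF : Continuous fun ω => f ω * strand κ (ξ a) η (ζ a) ω := hf.mul (hs a)
  obtain ⟨f', hc, hle, hg⟩ := hκ.exists_integral_trace (ζ := ζ) hN hξ hξζ hξη
    (continuous_coordIntegral hF (ξ a)) (S.erase a)
  refine ⟨f', hc, hle.trans ?_, fun g hgc hgi => ?_⟩
  · rw [Finset.card_erase_of_mem haS]
    exact mul_le_mul_of_nonneg_left
      (hκ.integral_sq_le_of_ignores_mid (hξη a) (hξζ a a) (hζη a) hf hfη) (pow_nonneg hN _)
  · rw [← hg g hgc fun i hi => hgi i (Finset.mem_of_mem_erase hi)]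
    simp_rw [mul_assoc]
    rw [← integral_mul_of_ignores hF]
    · refine integral_congr_ae (.of_forall fun ω => ?_)
      dsimp only
      rw [← Finset.mul_prod_erase _ _ haS]
      ring
    · exact (continuous_finsetProd _ fun i _ => hs i).mul hgc
    · exact (Ignores.prod fun i hi => ignores_strand
        (fun h => Finset.ne_of_mem_erase hi (hξ h).symm) (hξη a) (hξζ a i)).mul (hgi a haS)

/-- Norm of the operator attached to one end of a line. Its kernel is the product of three strands
sharing the group element `η`; `f` is a function of the near ends `ξ i` with `i ∉ R`, and `b` a
function of the near ends with `i ∈ R` and of all the far ends `ζ i`. -/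
theorem StrandKernel.sq_integral_mul_prod_le (hκ : StrandKernel N κ) (hN : 0 ≤ N) [Fintype α]
    (hξ : Function.Injective ξ) (hζ : Function.Injective ζ) (hξζ : ∀ i j, ξ i ≠ ζ j)
    (hξη : ∀ i, ξ i ≠ η) (hζη : ∀ i, η ≠ ζ i) {f b : (ι → SU2) → ℝ} (hf : Continuous f)
    (hb : Continuous b) (R : Finset α) (hfζ : ∀ i, Ignores f (ζ i))
    (hfξ : ∀ i ∈ R, Ignores f (ξ i)) (hbη : Ignores b η) (hbξ : ∀ i ∉ R, Ignores b (ξ i)) :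
    (∫ ω, f ω * b ω * ∏ i, strand κ (ξ i) η (ζ i) ω) ^ 2 ≤
      N ^ (R.card - 1) * ((∫ ω, f ω ^ 2) * ∫ ω, b ω ^ 2) := by
  have hs := fun i => hκ.continuous_strand (ξ i) η (ζ i)
  obtain ⟨f', hf'c, -, hf'j, hf'le, hf'⟩ := hκ.exists_integral_out hξ hζ hξζ hξη hζη hf Rᶜ
    fun i _ => hfζ i
  obtain ⟨b', hb'c, hb'le, hb'⟩ := hκ.exists_integral_in hN hξ hξζ hξη hζη hb hbη R
  have h1 : ∫ ω, f ω * b ω * ∏ i, strand κ (ξ i) η (ζ i) ω = ∫ ω, b' ω * f' ω := by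
    rw [← hb' f' hf'c fun i hi => hf'j _ (hξη i) (fun j _ => hξζ i j) (hfξ i hi)]
    have h2 := hf' (fun ω => b ω * ∏ i ∈ R, strand κ (ξ i) η (ζ i) ω)
      (hb.mul (continuous_finsetProd _ fun i _ => hs i)) fun i hi => by
        have hiR := Finset.mem_compl.1 hi
        exact (hbξ i hiR).mul (Ignores.prod fun j hj => ignores_strand
          (hξ.ne (ne_of_mem_of_not_mem hj hiR).symm) (hξη i) (hξζ i j))
    calc _ = _ := integral_congr_ae (.of_forall fun ω => ?_)
      _ = _ := h2
      _ = _ := integral_congr_ae (.of_forall fun ω => by ring)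
    rw [← Finset.prod_compl_mul_prod R]
    ring
  rw [h1]
  calc _ ≤ _ := sq_integral_mul_le (μ := volume) hb'c hf'c
    _ ≤ (N ^ (R.card - 1) * ∫ ω, b ω ^ 2) * ∫ ω, f ω ^ 2 :=
      mul_le_mul hb'le hf'le (integral_nonneg fun ω => sq_nonneg _)
        (mul_nonneg (pow_nonneg hN _) (integral_nonneg fun ω => sq_nonneg _))
    _ = _ := by ring

end Strand

/-! ### Ordering the fields of a connected graph -/

section Ordering

variable {V : Type*} [DecidableEq V]

/-- A connected graph with set of vertices `W`, every vertex of which carries four fields: the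
involution `τ` contracts the fields in pairs. -/
structure IsConnectedPairing (τ : V × Fin 4 → V × Fin 4) (W : Finset V) : Prop where
  mem : ∀ e, e.1 ∈ W → (τ e).1 ∈ W
  invol : ∀ e, e.1 ∈ W → τ (τ e) = e
  ne_self : ∀ e, e.1 ∈ W → τ e ≠ e
  conn : ∀ A ⊆ W, A.Nonempty → (∀ e, e.1 ∈ A → (τ e).1 ∈ A) → A = W

/-- An ordering of the fields such that the first field of every vertex except `s` is contracted
with an earlier field, and the last field of every vertex except `t` with a later one. Moreover the
first two fields of a vertex are never opposite (the opposite fields of a pillow have no argument in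
common). -/
structure IsTransferOrder (τ : V × Fin 4 → V × Fin 4) (W : Finset V) (pos : V × Fin 4 → ℚ)
    (s t : V) : Prop where
  inj : ∀ e e', e.1 ∈ W → e'.1 ∈ W → pos e = pos e' → e = e'
  vertex : ∀ v ∈ W, ∃ i j k l : Fin 4, pos (v, i) < pos (v, j) ∧ pos (v, j) < pos (v, k) ∧
    pos (v, k) < pos (v, l) ∧ j ≠ i + 2 ∧ (v ≠ s → pos (τ (v, i)) < pos (v, i)) ∧
    (v ≠ t → pos (v, l) < pos (τ (v, l)))

/-- Removal of the vertex `v`: the lines ending at the fields `i` and `π i` of `v` are joined. -/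
def rejoin (τ : V × Fin 4 → V × Fin 4) (v : V) (π : Fin 4 → Fin 4) (e : V × Fin 4) : V × Fin 4 :=
  if (τ e).1 = v then τ (v, π (τ e).2) else τ e

variable {τ : V × Fin 4 → V × Fin 4} {W : Finset V} {v : V} {π : Fin 4 → Fin 4}

theorem rejoin_of_eq {e : V × Fin 4} {i : Fin 4} (h : τ e = (v, i)) :
    rejoin τ v π e = τ (v, π i) := by
  simp [rejoin, h]

theorem rejoin_of_ne {e : V × Fin 4} (h : (τ e).1 ≠ v) : rejoin τ v π e = τ e := by
  simp [rejoin, h]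

namespace IsConnectedPairing

theorem rejoin_field (hτ : IsConnectedPairing τ W) (hv : v ∈ W) (i : Fin 4) :
    rejoin τ v π (τ (v, i)) = τ (v, π i) :=
  rejoin_of_eq (hτ.invol (v, i) hv)

/-- A set of vertices of the graph without `v` that is closed under the lines of the new graph
is reached by some line of `v`, and it is everything if it is reached by all lines of `v` that do
not return to `v`. -/
theorem closed_rejoin (hτ : IsConnectedPairing τ W) (hv : v ∈ W) {A : Finset V}
    (hA : A ⊆ W.erase v) (hne : A.Nonempty)
    (hcl : ∀ e : V × Fin 4, e.1 ∈ A → (rejoin τ v π e).1 ∈ A) :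
    (∃ i, (τ (v, i)).1 ∈ A) ∧ ((∀ i, (τ (v, i)).1 = v ∨ (τ (v, i)).1 ∈ A) → A = W.erase v) := by
  have hvA : v ∉ A := fun h => Finset.notMem_erase v W (hA h)
  have hAW : A ⊆ W := hA.trans (Finset.erase_subset _ _)
  constructor
  · by_contra! hcon
    refine hvA (?_ : v ∈ A)
    rw [hτ.conn A hAW hne fun e he => ?_]
    · exact hv
    by_cases h : (τ e).1 = v
    · have := hcon (τ e).2
      rw [← h, Prod.mk.eta, hτ.invol e (hAW he)] at this
      exact absurd he this
    · rw [← rejoin_of_ne (π := π) h]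
      exact hcl e he
  · intro hall
    have h1 : insert v A = W := by
      refine hτ.conn _ (Finset.insert_subset hv hAW) (Finset.insert_nonempty _ _) fun e he => ?_
      rw [Finset.mem_insert]
      rcases Finset.mem_insert.1 he with h | h
      · have := hall e.2
        rwa [← h, Prod.mk.eta, h] at this
      · by_cases h' : (τ e).1 = v
        · exact .inl h'
        · right
          rw [← rejoin_of_ne (π := π) h']
          exact hcl e h
    rw [← h1, Finset.erase_insert hvA]

theorem rejoin (hτ : IsConnectedPairing τ W) (hv : v ∈ W) (hπ : ∀ i, π (π i) = i)
    (hπne : ∀ i, π i ≠ i) (hself : ∀ i, (τ (v, i)).1 ≠ v → (τ (v, π i)).1 ≠ v)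
    (hconn : ∀ A ⊆ W.erase v, A.Nonempty →
      (∀ e : V × Fin 4, e.1 ∈ A → (rejoin τ v π e).1 ∈ A) → A = W.erase v) :
    IsConnectedPairing (rejoin τ v π) (W.erase v) := by
  have key : ∀ e : V × Fin 4, e.1 ∈ W.erase v → (∃ i, e = τ (v, i) ∧ τ e = (v, i)) ∨
      (τ e).1 ≠ v := by
    intro e he
    by_cases h : (τ e).1 = v
    · refine .inl ⟨(τ e).2, ?_, ?_⟩
      · rw [← h, Prod.mk.eta, hτ.invol e (Finset.mem_of_mem_erase he)]
      · rw [← h]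
    · exact .inr h
  refine ⟨fun e he => ?_, fun e he => ?_, fun e he => ?_, hconn⟩
  · rcases key e he with ⟨i, rfl, h⟩ | h
    · rw [hτ.rejoin_field hv]
      exact Finset.mem_erase.2 ⟨hself i (Finset.ne_of_mem_erase he), hτ.mem _ hv⟩
    · rw [rejoin_of_ne h]
      exact Finset.mem_erase.2 ⟨h, hτ.mem _ (Finset.mem_of_mem_erase he)⟩
  · rcases key e he with ⟨i, rfl, h⟩ | h
    · rw [hτ.rejoin_field hv, hτ.rejoin_field hv, hπ]
    · rw [rejoin_of_ne h, rejoin_of_ne, hτ.invol e (Finset.mem_of_mem_erase he)]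
      rw [hτ.invol e (Finset.mem_of_mem_erase he)]
      exact Finset.ne_of_mem_erase he
  · rcases key e he with ⟨i, rfl, h⟩ | h
    · rw [hτ.rejoin_field hv]
      intro h'
      have h2 := congrArg τ h'
      rw [hτ.invol _ hv, hτ.invol _ hv] at h2
      exact hπne i (congrArg Prod.snd h2)
    · rw [rejoin_of_ne h]
      exact hτ.ne_self e (Finset.mem_of_mem_erase he)

omit [DecidableEq V] in
theorem even_card_of_closed (hτ : IsConnectedPairing τ W) (F : Finset (V × Fin 4))
    (hF : ∀ e ∈ F, e.1 ∈ W) (hcl : ∀ e ∈ F, τ e ∈ F) : Even F.card := by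
  have h := Finset.sum_involution (s := F) (f := fun _ => (1 : ZMod 2)) (fun e _ => τ e)
    (fun _ _ => by decide) (fun e he _ => hτ.ne_self e (hF e he)) hcl
    (fun e he => hτ.invol e (hF e he))
  rw [Finset.sum_const, nsmul_one] at h
  exact (ZMod.natCast_eq_zero_iff_even).1 h

/-- If no line returns to `v`, then `v` can be removed in one of two ways, at least one of which
preserves connectedness: if both failed, there would be a set of vertices joined to its complement
by exactly one line, which is impossible because every vertex has an even number of fields. -/
theorem exists_rejoin (hτ : IsConnectedPairing τ W) (hv : v ∈ W)
    (hself : ∀ i, (τ (v, i)).1 ≠ v) :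
    IsConnectedPairing (BFL.rejoin τ v ![1, 0, 3, 2]) (W.erase v) ∨
      IsConnectedPairing (BFL.rejoin τ v ![3, 2, 1, 0]) (W.erase v) := by
  by_contra! hcon
  obtain ⟨h1, h2⟩ := hcon
  have h1' := mt (hτ.rejoin (π := ![1, 0, 3, 2]) hv (by decide) (by decide)
    (fun i _ => hself _)) h1
  have h2' := mt (hτ.rejoin (π := ![3, 2, 1, 0]) hv (by decide) (by decide)
    (fun i _ => hself _)) h2
  push Not at h1' h2'
  obtain ⟨A, hA, hAne, hAcl, hAW⟩ := h1'
  obtain ⟨B, hB, hBne, hBcl, hBW⟩ := h2'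
  obtain ⟨hA1, hA2⟩ := hτ.closed_rejoin hv hA hAne hAcl
  obtain ⟨hB1, hB2⟩ := hτ.closed_rejoin hv hB hBne hBcl
  have hA3 := mt hA2 hAW
  have hB3 := mt hB2 hBW
  simp only [hself, false_or] at hA3 hB3
  have hAst : ∀ i, (τ (v, i)).1 ∈ A → (τ (v, (![1, 0, 3, 2] : Fin 4 → Fin 4) i)).1 ∈ A :=
    fun i hi => by
      have := hAcl _ hi
      rwa [hτ.rejoin_field hv] at this
  have hBst : ∀ i, (τ (v, i)).1 ∈ B → (τ (v, (![3, 2, 1, 0] : Fin 4 → Fin 4) i)).1 ∈ B :=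
    fun i hi => by
      have := hBcl _ hi
      rwa [hτ.rejoin_field hv] at this
  -- exactly one line joins `v` to `A ∩ B`
  obtain ⟨x, hx⟩ : ∃ x, ∀ i, ((τ (v, i)).1 ∈ A ∧ (τ (v, i)).1 ∈ B) ↔ i = x := by
    have hcomb : ∀ P Q : Fin 4 → Bool, (∃ i, P i) → (¬ ∀ i, P i) → (∃ i, Q i) → (¬ ∀ i, Q i) →
        (∀ i, P i → P ((![1, 0, 3, 2] : Fin 4 → Fin 4) i)) →
        (∀ i, Q i → Q ((![3, 2, 1, 0] : Fin 4 → Fin 4) i)) →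
        ∃ x, ∀ i, (P i ∧ Q i) ↔ i = x := by
      decide
    have := hcomb (fun i => decide ((τ (v, i)).1 ∈ A)) (fun i => decide ((τ (v, i)).1 ∈ B))
    simp only [decide_eq_true_eq] at this
    exact this hA1 hA3 hB1 hB3 hAst hBst
  have hsub : A ∩ B ⊆ W.erase v := Finset.inter_subset_left.trans hA
  have hx' := (hx x).2 rfl
  have hmem : τ (v, x) ∈ (A ∩ B) ×ˢ (Finset.univ : Finset (Fin 4)) := by
    simpa using hx'
  have heven := hτ.even_card_of_closed (((A ∩ B) ×ˢ Finset.univ).erase (τ (v, x)))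
    (fun e he => Finset.mem_of_mem_erase
      (hsub (Finset.mem_product.1 (Finset.mem_of_mem_erase he)).1)) (fun e he => by
      rw [Finset.mem_erase, Finset.mem_product, Finset.mem_inter] at he
      obtain ⟨hne, ⟨heA, heB⟩, -⟩ := he
      have heW : e.1 ∈ W := Finset.mem_of_mem_erase (hA heA)
      have hev : (τ e).1 ≠ v := by
        intro h
        have h3 : e = τ (v, (τ e).2) := by rw [← h, Prod.mk.eta, hτ.invol e heW]
        refine hne ?_
        rw [h3, (hx (τ e).2).1 (h3 ▸ ⟨heA, heB⟩)]
      refine Finset.mem_erase.2 ⟨fun h => hev ?_, Finset.mem_product.2 ⟨Finset.mem_inter.2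
        ⟨?_, ?_⟩, Finset.mem_univ _⟩⟩
      · have h4 := congrArg τ h
        rw [hτ.invol _ heW, hτ.invol _ hv] at h4
        have h5 := Finset.ne_of_mem_erase (hA heA)
        exact absurd (congrArg Prod.fst h4) h5
      · have := hAcl e heA
        rwa [rejoin_of_ne hev] at this
      · have := hBcl e heB
        rwa [rejoin_of_ne hev] at this)
  rw [Finset.card_erase_of_mem hmem, Finset.card_product, Finset.card_univ, Fintype.card_fin]
    at heven
  have hpos : 0 < (A ∩ B).card := Finset.card_pos.2 ⟨_, Finset.mem_inter.2 hx'⟩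
  obtain ⟨m, hm⟩ := heven
  omega

end IsConnectedPairing

/-- Insertion of the fields of `v` into an ordering of the fields of the graph without `v`. -/
theorem IsTransferOrder.extend {pos : V × Fin 4 → ℚ} {s t : V}
    (hpos : IsTransferOrder (rejoin τ v π) (W.erase v) pos s t)
    (hτ : IsConnectedPairing τ W) (hv : v ∈ W) (hπ : ∀ i, π (π i) = i) (q : Fin 4 → ℚ)
    (hq : Function.Injective q) (hqpos : ∀ i e, e.1 ∈ W.erase v → q i ≠ pos e)
    (hline : ∀ i, (τ (v, i)).1 ≠ v → pos (τ (v, i)) < pos (τ (v, π i)) →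
      pos (τ (v, i)) < q i ∧ q (π i) < pos (τ (v, π i)))
    {i j k l : Fin 4} (hij : q i < q j) (hjk : q j < q k) (hkl : q k < q l) (hij2 : j ≠ i + 2)
    (hi : (τ (v, i)).1 ≠ v) (hi' : pos (τ (v, i)) < q i)
    (hl : (τ (v, l)).1 ≠ v) (hl' : q l < pos (τ (v, l)))
    (hself : ∀ i, (τ (v, i)).1 ≠ v → (τ (v, π i)).1 ≠ v) :
    IsTransferOrder τ W (fun e => if e.1 = v then q e.2 else pos e) s t := by
  have hmem : ∀ u ∈ W, u ≠ v → u ∈ W.erase v := fun u h h' => Finset.mem_erase.2 ⟨h', h⟩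
  refine ⟨fun e e' he he' h => ?_, fun u hu => ?_⟩
  · by_cases h1 : e.1 = v <;> by_cases h2 : e'.1 = v
    · simp only [h1, h2, if_true] at h
      exact Prod.ext (h1.trans h2.symm) (hq h)
    · simp only [h1, h2, if_true, if_false] at h
      exact absurd h (hqpos _ _ (hmem _ he' h2))
    · simp only [h1, h2, if_true, if_false] at h
      exact absurd h.symm (hqpos _ _ (hmem _ he h1))
    · simp only [h1, h2, if_false] at h
      exact hpos.inj e e' (hmem _ he h1) (hmem _ he' h2) h
  · by_cases huv : u = v
    · subst huv
      exact ⟨i, j, k, l, by simpa, by simpa, by simpa, hij2, fun _ => by simpa [hi],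
        fun _ => by simpa [hl]⟩
    obtain ⟨i, j, k, l, h1, h2, h3, h4, h5, h6⟩ := hpos.vertex u (hmem u hu huv)
    refine ⟨i, j, k, l, by simpa [huv], by simpa [huv], by simpa [huv], h4, fun hs => ?_,
      fun ht => ?_⟩
    · have h5 := h5 hs
      by_cases h : (τ (u, i)).1 = v
      · obtain ⟨x, hx⟩ : ∃ x, τ (u, i) = (v, x) := ⟨_, Prod.ext h rfl⟩
        have hx' : τ (v, x) = (u, i) := by rw [← hx, hτ.invol _ hu]
        rw [rejoin_of_eq hx] at h5
        have := hline (π x) (hself x (by rw [hx']; exact huv))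
        rw [hπ, hx'] at this
        simpa [huv, hx] using (this h5).2
      · rw [rejoin_of_ne h] at h5
        simpa [huv, h] using h5
    · have h6 := h6 ht
      by_cases h : (τ (u, l)).1 = v
      · obtain ⟨x, hx⟩ : ∃ x, τ (u, l) = (v, x) := ⟨_, Prod.ext h rfl⟩
        have hx' : τ (v, x) = (u, l) := by rw [← hx, hτ.invol _ hu]
        rw [rejoin_of_eq hx] at h6
        have := hline x (by rw [hx']; exact huv)
        rw [hx'] at this
        simpa [huv, hx] using (this h6).1
      · rw [rejoin_of_ne h] at h6
        simpa [huv, h] using h6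

theorem exists_between_notMem (F : Finset ℚ) {x y : ℚ} (h : x < y) :
    ∃ r, x < r ∧ r < y ∧ r ∉ F := by
  obtain ⟨r, hr, hrF⟩ := (Set.Ioo_infinite h).exists_notMem_finset F
  exact ⟨r, hr.1, hr.2, hrF⟩

theorem exists_two_between_notMem (F : Finset ℚ) {x y : ℚ} (h : x < y) :
    ∃ r₁ r₂, x < r₁ ∧ r₁ < r₂ ∧ r₂ < y ∧ r₁ ∉ F ∧ r₂ ∉ F := by
  obtain ⟨r₁, h1, h2, h3⟩ := exists_between_notMem F h
  obtain ⟨r₂, h4, h5, h6⟩ := exists_between_notMem F h2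
  exact ⟨r₁, r₂, h1, h4, h5, h3, h6⟩

theorem eq_or_of_ne {a b c d : Fin 4} (hab : a ≠ b) (hac : a ≠ c) (had : a ≠ d) (hbc : b ≠ c)
    (hbd : b ≠ d) (hcd : c ≠ d) (i : Fin 4) : i = a ∨ i = b ∨ i = c ∨ i = d := by
  omega

theorem exists_increasing {a b c d : Fin 4} (hab : a ≠ b) (hac : a ≠ c) (had : a ≠ d) (hbc : b ≠ c)
    (hbd : b ≠ d) (hcd : c ≠ d) {r₁ r₂ r₃ r₄ : ℚ} (h12 : r₁ < r₂) (h23 : r₂ < r₃) (h34 : r₃ < r₄) :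
    ∃ q : Fin 4 → ℚ, Function.Injective q ∧ q a = r₁ ∧ q b = r₂ ∧ q c = r₃ ∧ q d = r₄ := by
  have hcases := eq_or_of_ne hab hac had hbc hbd hcd
  obtain ⟨q, ha, hb, hc, hd⟩ : ∃ q : Fin 4 → ℚ, q a = r₁ ∧ q b = r₂ ∧ q c = r₃ ∧ q d = r₄ :=
    ⟨fun i => if i = a then r₁ else if i = b then r₂ else if i = c then r₃ else r₄,
      by simp, by simp [hab.symm], by simp [hac.symm, hbc.symm],
      by simp [had.symm, hbd.symm, hcd.symm]⟩
  refine ⟨q, fun i j h => ?_, ha, hb, hc, hd⟩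
  rcases hcases i with rfl | rfl | rfl | rfl <;> rcases hcases j with rfl | rfl | rfl | rfl <;>
    first | rfl | (exfalso; linarith)

/-- The case where a line returns to `v`: the other two lines of `v` are joined, and all fields of
`v` are inserted between the ends of the new line. -/
theorem exists_transferOrder_of_self
    (ih : ∀ τ' : V × Fin 4 → V × Fin 4, IsConnectedPairing τ' (W.erase v) →
      ∃ pos s t, IsTransferOrder τ' (W.erase v) pos s t)
    (hτ : IsConnectedPairing τ W) (hv : v ∈ W) (hW : W ≠ {v}) {a : Fin 4}
    (ha : (τ (v, a)).1 = v) : ∃ pos s t, IsTransferOrder τ W pos s t := by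
  obtain ⟨b, hb⟩ : ∃ b, τ (v, a) = (v, b) := ⟨_, Prod.ext ha rfl⟩
  have hba : τ (v, b) = (v, a) := by rw [← hb, hτ.invol _ hv]
  have hab : a ≠ b := by
    rintro rfl
    exact hτ.ne_self (v, a) hv hb
  obtain ⟨c, d, π, hac, had, hbc, hbd, hcd, hπ, hπne, hπa, hπb, hπc, hπd⟩ :
      ∃ c d : Fin 4, ∃ π : Fin 4 → Fin 4, a ≠ c ∧ a ≠ d ∧ b ≠ c ∧ b ≠ d ∧ c ≠ d ∧
        (∀ i, π (π i) = i) ∧ (∀ i, π i ≠ i) ∧ π a = b ∧ π b = a ∧ π c = d ∧ π d = c := by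
    have : ∀ a b : Fin 4, a ≠ b → ∃ c d : Fin 4, a ≠ c ∧ a ≠ d ∧ b ≠ c ∧ b ≠ d ∧ c ≠ d := by
      decide
    obtain ⟨c, d, hac, had, hbc, hbd, hcd⟩ := this a b hab
    obtain ⟨π, h1, h2, h3, h4⟩ : ∃ π : Fin 4 → Fin 4, π a = b ∧ π b = a ∧ π c = d ∧ π d = c :=
      ⟨fun i => if i = a then b else if i = b then a else if i = c then d else c,
        by simp, by simp [hab.symm], by simp [hac.symm, hbc.symm],
        by simp [had.symm, hbd.symm, hcd.symm]⟩
    have hcases := eq_or_of_ne hab hac had hbc hbd hcd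
    refine ⟨c, d, π, hac, had, hbc, hbd, hcd, fun i => ?_, fun i => ?_, h1, h2, h3, h4⟩
    · rcases hcases i with rfl | rfl | rfl | rfl <;> simp [h1, h2, h3, h4]
    · rcases hcases i with rfl | rfl | rfl | rfl <;>
        simp [h1, h2, h3, h4, hab, hab.symm, hcd, hcd.symm]
  have hcases := eq_or_of_ne hab hac had hbc hbd hcd
  have hcd' : (τ (v, c)).1 ≠ v ∧ (τ (v, d)).1 ≠ v := by
    by_contra hcon
    -- if one of the other two fields returns to `v`, so does the other
    have hother : ∀ x y : Fin 4, x ≠ a → x ≠ b → (∀ i, i = a ∨ i = b ∨ i = x ∨ i = y) →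
        (τ (v, x)).1 = v → (τ (v, y)).1 = v := by
      intro x y hxa hxb hxy hx
      obtain ⟨z, hz⟩ : ∃ z, τ (v, x) = (v, z) := ⟨_, Prod.ext hx rfl⟩
      have hz' : τ (v, z) = (v, x) := by rw [← hz, hτ.invol _ hv]
      rcases hxy z with rfl | rfl | rfl | rfl
      · rw [hb] at hz'
        exact absurd (congrArg Prod.snd hz').symm hxb
      · rw [hba] at hz'
        exact absurd (congrArg Prod.snd hz').symm hxa
      · exact absurd hz (hτ.ne_self _ hv)
      · rw [hz']
    have hall : (τ (v, c)).1 = v ∧ (τ (v, d)).1 = v := by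
      by_cases h : (τ (v, c)).1 = v
      · exact ⟨h, hother c d hac.symm hbc.symm hcases h⟩
      · have h' : (τ (v, d)).1 = v := by
          by_contra h'
          exact hcon ⟨h, h'⟩
        exact ⟨hother d c had.symm hbd.symm (fun i => by have := hcases i; tauto) h', h'⟩
    refine hW (hτ.conn {v} (by simpa using hv) (by simp) ?_).symm
    rintro ⟨u, i⟩ hu
    obtain rfl : u = v := by simpa using hu
    rcases hcases i with rfl | rfl | rfl | rfl
    · simp [hb]
    · simp [hba]
    · simp [hall.1]
    · simp [hall.2]
  have hself : ∀ i, (τ (v, i)).1 ≠ v → (τ (v, π i)).1 ≠ v := by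
    intro i hi
    rcases hcases i with rfl | rfl | rfl | rfl
    · exact absurd ha hi
    · simp [hba] at hi
    · rw [hπc]; exact hcd'.2
    · rw [hπd]; exact hcd'.1
  have hτ' := hτ.rejoin hv hπ hπne hself fun A hA hne hcl => by
    obtain ⟨⟨x, hx⟩, h2⟩ := hτ.closed_rejoin hv hA hne hcl
    have hvA : v ∉ A := fun h => Finset.notMem_erase v W (hA h)
    refine h2 fun i => ?_
    have hst : (τ (v, π x)).1 ∈ A := by
      have := hcl _ hx
      rwa [hτ.rejoin_field hv] at this
    have hcA : (τ (v, c)).1 ∈ A ∧ (τ (v, d)).1 ∈ A := by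
      rcases hcases x with rfl | rfl | rfl | rfl
      · exact absurd (ha ▸ hx) hvA
      · rw [hba] at hx
        exact absurd hx hvA
      · exact ⟨hx, hπc ▸ hst⟩
      · exact ⟨hπd ▸ hst, hx⟩
    rcases hcases i with rfl | rfl | rfl | rfl
    · exact .inl ha
    · left; rw [hba]
    · exact .inr hcA.1
    · exact .inr hcA.2
  obtain ⟨pos, s, t, hpos⟩ := ih _ hτ'
  -- the two ends of the new line, the earlier one being the partner of the field `c`
  obtain ⟨c, d, hac, had, hbc, hbd, hcd, hπc, hπd, hcd', hlt⟩ : ∃ c d : Fin 4, a ≠ c ∧ a ≠ d ∧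
      b ≠ c ∧ b ≠ d ∧ c ≠ d ∧ π c = d ∧ π d = c ∧ ((τ (v, c)).1 ≠ v ∧ (τ (v, d)).1 ≠ v) ∧
      pos (τ (v, c)) < pos (τ (v, d)) := by
    rcases lt_trichotomy (pos (τ (v, c))) (pos (τ (v, d))) with h | h | h
    · exact ⟨c, d, hac, had, hbc, hbd, hcd, hπc, hπd, hcd', h⟩
    · have h1 := hpos.inj _ _ (Finset.mem_erase.2 ⟨hcd'.1, hτ.mem _ hv⟩)
        (Finset.mem_erase.2 ⟨hcd'.2, hτ.mem _ hv⟩) h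
      have h2 := congrArg τ h1
      rw [hτ.invol _ hv, hτ.invol _ hv] at h2
      exact absurd (congrArg Prod.snd h2) hcd
    · exact ⟨d, c, had, hac, hbd, hbc, hcd.symm, hπd, hπc, hcd'.symm, h⟩
  -- of the two fields of the line returning to `v`, one is not opposite to `c`
  obtain ⟨x, y, hxy, hxc, hxd, hyc, hyd, hx, hxs, hys⟩ : ∃ x y : Fin 4, x ≠ y ∧ x ≠ c ∧ x ≠ d ∧
      y ≠ c ∧ y ≠ d ∧ x ≠ c + 2 ∧ (τ (v, x)).1 = v ∧ (τ (v, y)).1 = v := by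
    by_cases h : a = c + 2
    · exact ⟨b, a, hab.symm, hbc, hbd, hac, had, fun h' => hab (h.trans h'.symm), by rw [hba], ha⟩
    · exact ⟨a, b, hab, hac, had, hbc, hbd, h, ha, by rw [hba]⟩
  let F := ((W.erase v) ×ˢ Finset.univ).image pos
  have hF : ∀ r ∉ F, ∀ e : V × Fin 4, e.1 ∈ W.erase v → r ≠ pos e := fun r hr e he h =>
    hr (Finset.mem_image.2 ⟨e, Finset.mem_product.2 ⟨he, Finset.mem_univ _⟩, h.symm⟩)
  obtain ⟨r₁, m, hr₁, hr₁m, hm, hr₁F, -⟩ := exists_two_between_notMem F hlt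
  obtain ⟨r₂, m', hr₂, hr₂m, hm', hr₂F, -⟩ := exists_two_between_notMem F hm
  obtain ⟨r₃, r₄, hr₃, hr₄, hr₄', hr₃F, hr₄F⟩ := exists_two_between_notMem F hm'
  obtain ⟨q, hq, hqc, hqx, hqy, hqd⟩ := exists_increasing hxc.symm hyc.symm hcd hxy hxd hyd
    (hr₁m.trans hr₂) (hr₂m.trans hr₃) hr₄
  have hcases := eq_or_of_ne hxc.symm hyc.symm hcd hxy hxd hyd
  refine ⟨_, s, t, hpos.extend hτ hv hπ q hq (fun i e he => ?_) (fun i hi hlt' => ?_)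
    (i := c) (j := x) (k := y) (l := d) ?_ ?_ ?_ hx hcd'.1 ?_ hcd'.2 ?_ hself⟩
  · rcases hcases i with rfl | rfl | rfl | rfl
    · rw [hqc]; exact hF _ hr₁F e he
    · rw [hqx]; exact hF _ hr₂F e he
    · rw [hqy]; exact hF _ hr₃F e he
    · rw [hqd]; exact hF _ hr₄F e he
  · rcases hcases i with rfl | rfl | rfl | rfl
    · rw [hπc, hqc, hqd]; exact ⟨hr₁, hr₄'⟩
    · exact absurd hxs hi
    · exact absurd hys hi
    · rw [hπd] at hlt'
      exact absurd hlt' hlt.not_gt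
  · rw [hqc, hqx]; exact hr₁m.trans hr₂
  · rw [hqx, hqy]; exact hr₂m.trans hr₃
  · rw [hqy, hqd]; exact hr₄
  · rw [hqc]; exact hr₁
  · rw [hqd]; exact hr₄'

/-- The case where no line returns to `v`: the lines of `v` are joined in pairs, and for each of the
two new lines, two fields of `v` are inserted after its earlier end. -/
theorem IsTransferOrder.exists_extend {pos : V × Fin 4 → ℚ} {s t : V}
    (hpos : IsTransferOrder (rejoin τ v π) (W.erase v) pos s t)
    (hτ : IsConnectedPairing τ W) (hv : v ∈ W) (hself : ∀ i, (τ (v, i)).1 ≠ v)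
    (hπ : ∀ i, π (π i) = i) (hπne : ∀ i, π i ≠ i) (hπ2 : ∀ i, π i ≠ i + 2) :
    ∃ pos s t, IsTransferOrder τ W pos s t := by
  have hinj : ∀ i j, pos (τ (v, i)) = pos (τ (v, j)) → i = j := by
    intro i j h
    have h1 := hpos.inj _ _ (Finset.mem_erase.2 ⟨hself i, hτ.mem _ hv⟩)
      (Finset.mem_erase.2 ⟨hself j, hτ.mem _ hv⟩) h
    have h2 := congrArg τ h1
    rw [hτ.invol _ hv, hτ.invol _ hv] at h2
    exact congrArg Prod.snd h2
  -- `a` is the field whose partner comes first, `c` the earlier field of the other new line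
  obtain ⟨a, ha⟩ := Finite.exists_min fun i => pos (τ (v, i))
  obtain ⟨c, hca, hcb, hc⟩ : ∃ c, c ≠ a ∧ c ≠ π a ∧ pos (τ (v, c)) < pos (τ (v, π c)) := by
    obtain ⟨c, hca, hcb⟩ : ∃ c, c ≠ a ∧ c ≠ π a := by
      have : ∀ x y : Fin 4, ∃ z, z ≠ x ∧ z ≠ y := by decide
      exact this _ _
    rcases lt_trichotomy (pos (τ (v, c))) (pos (τ (v, π c))) with h | h | h
    · exact ⟨c, hca, hcb, h⟩
    · exact absurd (hinj _ _ h).symm (hπne c)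
    · refine ⟨π c, fun h' => hcb ?_, fun h' => hca ?_, by rwa [hπ]⟩
      · rw [← h', hπ]
      · rw [← hπ c, h', hπ]
  have hab : a ≠ π a := (hπne a).symm
  have hcd : c ≠ π c := (hπne c).symm
  have had : a ≠ π c := fun h => hcb (by rw [h, hπ])
  have hbd : π a ≠ π c := fun h => hca (by rw [← hπ c, ← h, hπ])
  have hcases := eq_or_of_ne hab hca.symm had hcb.symm hbd hcd
  have hlt : ∀ i, i ≠ a → pos (τ (v, a)) < pos (τ (v, i)) := fun i hi =>
    lt_of_le_of_ne (ha i) fun h => hi (hinj _ _ h).symm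
  let F := ((W.erase v) ×ˢ Finset.univ).image pos
  have hF : ∀ r ∉ F, ∀ e : V × Fin 4, e.1 ∈ W.erase v → r ≠ pos e := fun r hr e he h =>
    hr (Finset.mem_image.2 ⟨e, Finset.mem_product.2 ⟨he, Finset.mem_univ _⟩, h.symm⟩)
  obtain ⟨r₁, r₂, hr₁, hr₁₂, hr₂, hr₁F, hr₂F⟩ := exists_two_between_notMem F
    (lt_min (hlt (π a) hab.symm) (hlt c hca))
  obtain ⟨r₃, r₄, hr₃, hr₃₄, hr₄, hr₃F, hr₄F⟩ := exists_two_between_notMem F hc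
  have hr₂₃ : r₂ < r₃ := (hr₂.trans_le (min_le_right _ _)).trans hr₃
  obtain ⟨q, hq, hqa, hqb, hqc, hqd⟩ := exists_increasing hab hca.symm had hcb.symm hbd hcd
    hr₁₂ hr₂₃ hr₃₄
  refine ⟨_, s, t, hpos.extend hτ hv hπ q hq (fun i e he => ?_) (fun i hi hlt' => ?_)
    (i := a) (j := π a) (k := c) (l := π c) ?_ ?_ ?_ (hπ2 a) (hself _) ?_ (hself _) ?_
    fun i _ => hself _⟩
  · rcases hcases i with h | h | h | h <;> rw [h]
    · rw [hqa]; exact hF _ hr₁F e he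
    · rw [hqb]; exact hF _ hr₂F e he
    · rw [hqc]; exact hF _ hr₃F e he
    · rw [hqd]; exact hF _ hr₄F e he
  · rcases hcases i with h | h | h | h <;> rw [h] at hlt' ⊢
    · rw [hqa, hqb]; exact ⟨hr₁, hr₂.trans_le (min_le_left _ _)⟩
    · rw [hπ] at hlt'
      exact absurd hlt' (hlt _ hab.symm).not_gt
    · rw [hqc, hqd]; exact ⟨hr₃, hr₄⟩
    · rw [hπ] at hlt'
      exact absurd hlt' hc.not_gt
  · rw [hqa, hqb]; exact hr₁₂
  · rw [hqb, hqc]; exact hr₂₃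
  · rw [hqc, hqd]; exact hr₃₄
  · rw [hqa]; exact hr₁
  · rw [hqd]; exact hr₄

theorem exists_transferOrder (hne : W.Nonempty) (hτ : IsConnectedPairing τ W) :
    ∃ pos s t, IsTransferOrder τ W pos s t := by
  induction hn : W.card using Nat.strong_induction_on generalizing W τ with
  | _ n ih =>
    obtain ⟨v, hv⟩ := hne
    by_cases hW : W = {v}
    · subst hW
      refine ⟨fun e => (e.2 : ℕ), v, v, fun e e' he he' h => ?_, fun u hu => ?_⟩
      · rw [Finset.mem_singleton] at he he'
        exact Prod.ext (he.trans he'.symm) (Fin.ext (by exact_mod_cast h))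
      · rw [Finset.mem_singleton] at hu
        exact ⟨0, 1, 2, 3, by norm_num, by norm_num, by norm_num, by decide,
          fun h => absurd hu h, fun h => absurd hu h⟩
    have hne' : (W.erase v).Nonempty := by
      rw [Finset.nonempty_iff_ne_empty]
      intro h
      rcases (Finset.erase_eq_empty_iff _ _).1 h with h | h
      · rw [h] at hv
        simp at hv
      · exact hW h
    have hcard : (W.erase v).card < n := hn ▸ Finset.card_erase_lt_of_mem hv
    by_cases hself : ∀ i, (τ (v, i)).1 ≠ v
    · rcases hτ.exists_rejoin hv hself with h | h
      · obtain ⟨pos, s, t, hpos⟩ := ih _ hcard hne' h rfl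
        exact hpos.exists_extend hτ hv hself (by decide) (by decide) (by decide)
      · obtain ⟨pos, s, t, hpos⟩ := ih _ hcard hne' h rfl
        exact hpos.exists_extend hτ hv hself (by decide) (by decide) (by decide)
    · push Not at hself
      obtain ⟨a, ha⟩ := hself
      exact exists_transferOrder_of_self (fun τ' hτ' => ih _ hcard hne' hτ' rfl) hτ hv hW ha

end Ordering

/-! ### Power counting for a graph -/

namespace VacuumGraph

variable {V L : Type}

/-- The field contracted with the field `e`. -/
def partner (G : VacuumGraph V L) (e : V × Fin 4) : V × Fin 4 :=
  G.ends ((G.ends.symm e).1, (G.ends.symm e).2 + 1)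

theorem partner_ends (G : VacuumGraph V L) (l : L) (s : Fin 2) :
    G.partner (G.ends (l, s)) = G.ends (l, s + 1) := by
  simp [partner]

theorem partner_partner (G : VacuumGraph V L) (e : V × Fin 4) : G.partner (G.partner e) = e := by
  obtain ⟨⟨l, s⟩, rfl⟩ := G.ends.surjective e
  rw [partner_ends, partner_ends]
  congr 2
  fin_cases s <;> rfl

theorem partner_ne (G : VacuumGraph V L) (e : V × Fin 4) : G.partner e ≠ e := by
  obtain ⟨⟨l, s⟩, rfl⟩ := G.ends.surjective e
  rw [partner_ends]
  intro h
  exact (by decide : ∀ s : Fin 2, s + 1 ≠ s) s (congrArg Prod.snd (G.ends.injective h))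

theorem eq_or_eq_partner (G : VacuumGraph V L) {e e' : V × Fin 4}
    (h : (G.ends.symm e').1 = (G.ends.symm e).1) : e' = e ∨ e' = G.partner e := by
  obtain ⟨⟨l, s⟩, rfl⟩ := G.ends.surjective e
  obtain ⟨⟨l', s'⟩, rfl⟩ := G.ends.surjective e'
  obtain rfl : l' = l := by simpa using h
  rw [partner_ends]
  rcases (by decide : ∀ s s' : Fin 2, s' = s ∨ s' = s + 1) s s' with rfl | rfl <;> simp

theorem isConnectedPairing [Fintype V] (G : VacuumGraph V L) (hG : G.Connected) :
    IsConnectedPairing G.partner Finset.univ := by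
  refine ⟨fun _ _ => Finset.mem_univ _, fun e _ => G.partner_partner e,
    fun e _ => G.partner_ne e, fun A _ hne hcl => ?_⟩
  obtain ⟨a, ha⟩ := hne
  refine Finset.eq_univ_of_forall fun w => ?_
  obtain ⟨p⟩ := hG.preconnected a w
  induction p with
  | nil => exact ha
  | @cons u v w h _ ih =>
    refine ih ?_
    rw [SimpleGraph.fromRel_adj] at h
    rcases h.2 with ⟨l, h0, h1⟩ | ⟨l, h0, h1⟩
    · have := hcl (G.ends (l, 0)) (h0 ▸ ha)
      rwa [partner_ends, zero_add, h1] at this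
    · have := hcl (G.ends (l, 1)) (h1 ▸ ha)
      rwa [partner_ends, show (1 + 1 : Fin 2) = 0 from rfl, h0] at this

end VacuumGraph

/-- The arguments of the `k`-th field of a vertex that are not arguments of a field in `s`. -/
def newArgs (t : VertexType) (s : Finset (Fin 4)) (k : Fin 4) : Finset (Fin 3) :=
  Finset.univ.filter fun a => ∀ k' ∈ s, ∀ b, slot t k' b ≠ slot t k a

theorem newArgs_empty (t : VertexType) (k : Fin 4) : newArgs t ∅ k = Finset.univ := by
  simp [newArgs]

theorem card_newArgs_second (t : VertexType) : ∀ i j : Fin 4, i ≠ j → j ≠ i + 2 →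
    1 ≤ (newArgs t {i} j).card ∧ (newArgs t {i} j).card ≤ 2 := by
  cases t <;> decide

theorem card_newArgs_third (t : VertexType) : ∀ i j k : Fin 4, i ≠ j → j ≠ i + 2 → i ≠ k → j ≠ k →
    1 ≤ (newArgs t {i, j} k).card ∧ (newArgs t {i, j} k).card ≤ 2 := by
  cases t <;> decide

theorem newArgs_last (t : VertexType) : ∀ k : Fin 4, newArgs t {k}ᶜ k = ∅ := by
  cases t <;> decide

theorem slot_injective (t : VertexType) : ∀ k, Function.Injective (slot t k) := by
  unfold Function.Injective
  cases t <;> decide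

/-- Each of the six variables of a vertex is an argument of only two fields. -/
theorem eq_of_slot_eq (t : VertexType) : ∀ (k k₁ k₂ : Fin 4) (a b₁ b₂ : Fin 3), k₁ ≠ k → k₂ ≠ k →
    slot t k₁ b₁ = slot t k a → slot t k₂ b₂ = slot t k a → k₁ = k₂ := by
  cases t <;> decide

section PowerCounting

variable {V L : Type} (G : VacuumGraph V L)

/-- The integration variables of a graph, all in `SU(2)`: six for each vertex; for each line, the
three arguments of a point inserted in the middle of the line, and the group elements of the
averagings at its two ends. -/
abbrev GraphVar (V L : Type) : Type := (V × Fin 6) ⊕ (L × (Fin 3 ⊕ Fin 2))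

/-- The variable of a vertex which is the `i`-th argument of the field `e`. -/
def VacuumGraph.argVar (e : V × Fin 4) (i : Fin 3) : GraphVar V L :=
  .inl (e.1, slot (G.type e.1) e.2 i)

/-- The group element of the averaging attached to the field `e`. -/
def VacuumGraph.avgVar (e : V × Fin 4) : GraphVar V L :=
  .inr ((G.ends.symm e).1, .inr (G.ends.symm e).2)

/-- The `i`-th variable in the middle of the line of the field `e`. -/
def VacuumGraph.midVar (e : V × Fin 4) (i : Fin 3) : GraphVar V L :=
  .inr ((G.ends.symm e).1, .inl i)

/-- The power of `√N` in the norm of the operator attached to the field `e`. -/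
def VacuumGraph.cost (pos : V × Fin 4 → ℚ) (e : V × Fin 4) : ℕ :=
  let U := newArgs (G.type e.1) (Finset.univ.filter fun k => pos (e.1, k) < pos e) e.2
  if pos e < pos (G.partner e) then U.card - 1 else Uᶜ.card - 1

/-- The fields of a vertex contribute at most two powers of `√N`, with two more for the vertices at
which the ordering of the fields starts and stops. -/
theorem VacuumGraph.sum_cost_le [DecidableEq V] (pos : V × Fin 4 → ℚ) (v s t : V) {i j k l : Fin 4}
    (hij : pos (v, i) < pos (v, j)) (hjk : pos (v, j) < pos (v, k)) (hkl : pos (v, k) < pos (v, l))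
    (hij2 : j ≠ i + 2) (hs : v ≠ s → pos (G.partner (v, i)) < pos (v, i))
    (ht : v ≠ t → pos (v, l) < pos (G.partner (v, l))) :
    ∑ k, G.cost pos (v, k) ≤ 2 + (if v = s then 2 else 0) + (if v = t then 2 else 0) := by
  have hne : ∀ {a b : Fin 4}, pos (v, a) < pos (v, b) → a ≠ b := fun h h' => by
    rw [h'] at h; exact lt_irrefl _ h
  have hik := hij.trans hjk
  have hil := hik.trans hkl
  have hjl := hjk.trans hkl
  have hcases := eq_or_of_ne (hne hij) (hne hik) (hne hil) (hne hjk) (hne hjl) (hne hkl)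
  have hsum : ∑ k, G.cost pos (v, k) =
      G.cost pos (v, i) + G.cost pos (v, j) + G.cost pos (v, k) + G.cost pos (v, l) := by
    have huniv : (Finset.univ : Finset (Fin 4)) = {i, j, k, l} := by
      ext a; simpa using hcases a
    rw [huniv, Finset.sum_insert (by simp [hne hij, hne hik, hne hil]),
      Finset.sum_insert (by simp [hne hjk, hne hjl]), Finset.sum_insert (by simp [hne hkl]),
      Finset.sum_singleton]
    ring
  have hcard : ∀ U : Finset (Fin 3), U.card + Uᶜ.card = 3 := fun U => by
    rw [Finset.card_add_card_compl, Fintype.card_fin]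
  have hEi : (Finset.univ.filter fun a => pos (v, a) < pos (v, i)) = ∅ := by
    ext a
    rcases hcases a with rfl | rfl | rfl | rfl <;> simp [hij.le, hik.le, hil.le]
  have hEj : (Finset.univ.filter fun a => pos (v, a) < pos (v, j)) = {i} := by
    ext a
    rcases hcases a with rfl | rfl | rfl | rfl <;>
      simp [hij, hjk.le, hjl.le, (hne hij).symm, (hne hik).symm, (hne hil).symm]
  have hEk : (Finset.univ.filter fun a => pos (v, a) < pos (v, k)) = {i, j} := by
    ext a
    rcases hcases a with rfl | rfl | rfl | rfl <;>
      simp [hik, hjk, hkl.le, (hne hik).symm, (hne hil).symm, (hne hjk).symm, (hne hjl).symm]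
  have hEl : (Finset.univ.filter fun a => pos (v, a) < pos (v, l)) = {l}ᶜ := by
    ext a
    rcases hcases a with rfl | rfl | rfl | rfl <;> simp [hil, hjl, hkl, hne hil, hne hjl, hne hkl]
  have hj := card_newArgs_second (G.type v) i j (hne hij) hij2
  have hk := card_newArgs_third (G.type v) i j k (hne hij) hij2 (hne hik) (hne hjk)
  have ci : G.cost pos (v, i) ≤ if v = s then 2 else 0 := by
    simp only [cost, hEi, newArgs_empty, Finset.card_univ, Fintype.card_fin, Finset.compl_univ,
      Finset.card_empty]
    by_cases h : v = s
    · simp only [h, if_true]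
      split_ifs <;> omega
    · simp [h, (hs h).le]
  have cl : G.cost pos (v, l) ≤ if v = t then 2 else 0 := by
    simp only [cost, hEl, newArgs_last, Finset.compl_empty, Finset.card_univ, Fintype.card_fin,
      Finset.card_empty]
    by_cases h : v = t
    · simp only [h, if_true]
      split_ifs <;> omega
    · simp [h, ht h]
  have cj : G.cost pos (v, j) ≤ 1 := by
    simp only [cost, hEj]
    have := hcard (newArgs (G.type v) {i} j)
    split_ifs <;> omega
  have ck : G.cost pos (v, k) ≤ 1 := by
    simp only [cost, hEk]
    have := hcard (newArgs (G.type v) {i, j} k)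
    split_ifs <;> omega
  rw [hsum]
  omega

variable [DecidableEq V] [DecidableEq L]

/-- All the variables on which the kernel of the field `e` depends. -/
def VacuumGraph.touched (e : V × Fin 4) : Finset (GraphVar V L) :=
  Finset.univ.image (G.argVar e) ∪ Finset.univ.image (G.midVar e) ∪ {G.avgVar e}

theorem VacuumGraph.argVar_mem_touched {e e' : V × Fin 4} {i : Fin 3} :
    G.argVar e i ∈ G.touched e' ↔
      e'.1 = e.1 ∧ ∃ j, slot (G.type e.1) e'.2 j = slot (G.type e.1) e.2 i := by
  simp only [touched, argVar, midVar, avgVar, Finset.mem_union, Finset.mem_image, Finset.mem_univ,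
    true_and, Finset.mem_singleton, Sum.inl.injEq, Prod.mk.injEq, reduceCtorEq, exists_const,
    or_false]
  constructor
  · rintro ⟨j, h1, h2⟩
    exact ⟨h1, j, by rw [← h1] at h2 ⊢; exact h2⟩
  · rintro ⟨h1, j, h2⟩
    exact ⟨j, h1, by rw [h1]; exact h2⟩

theorem VacuumGraph.midVar_mem_touched {e e' : V × Fin 4} {i : Fin 3}
    (h : G.midVar e i ∈ G.touched e') : e' = e ∨ e' = G.partner e := by
  simp only [touched, argVar, midVar, avgVar, Finset.mem_union, Finset.mem_image, Finset.mem_univ,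
    true_and, Finset.mem_singleton, Sum.inr.injEq, Prod.mk.injEq, reduceCtorEq, exists_const,
    false_or, and_false, or_false, exists_and_left] at h
  exact G.eq_or_eq_partner h.1

theorem VacuumGraph.avgVar_mem_touched {e e' : V × Fin 4}
    (h : G.avgVar e ∈ G.touched e') : e' = e := by
  simp only [touched, argVar, midVar, avgVar, Finset.mem_union, Finset.mem_image, Finset.mem_univ,
    Finset.mem_singleton, Sum.inr.injEq, Prod.mk.injEq, reduceCtorEq, exists_const,
    false_or, and_false, or_false] at h
  exact (G.ends.symm.injective (Prod.ext h.1 h.2)).symm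

variable [Fintype V] [Fintype L]

/-- The product over all fields of the kernels attached to them, the arguments of the field `e`
being joined to the middle of its line according to the permutation `σ e`. -/
theorem VacuumGraph.abs_integral_prod_strand_le (hG : G.Connected) {N : ℝ} (hN : 1 ≤ N)
    {κ : SU2 → SU2 → ℝ} (hκ : StrandKernel N κ) (σ : V × Fin 4 → Equiv.Perm (Fin 3)) :
    |∫ ω : GraphVar V L → SU2,
        ∏ e, ∏ i, strand κ (G.argVar e i) (G.avgVar e) (G.midVar e (σ e i)) ω| ≤
      N ^ (Fintype.card V + 2) := by
  have hN0 : 0 ≤ N := zero_le_one.trans hN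
  obtain ⟨v₀⟩ := hG.nonempty
  obtain ⟨pos, s, t, hpos⟩ := exists_transferOrder ⟨v₀, Finset.mem_univ _⟩ (G.isConnectedPairing hG)
  have hinj : Function.Injective pos := fun e e' h =>
    hpos.inj e e' (Finset.mem_univ _) (Finset.mem_univ _) h
  have hK : ∀ e, Continuous fun ω : GraphVar V L → SU2 =>
      ∏ i, strand κ (G.argVar e i) (G.avgVar e) (G.midVar e (σ e i)) ω := fun e =>
    continuous_finsetProd _ fun i _ => hκ.continuous_strand _ _ _
  have harg : ∀ e i, G.argVar e i ∈ G.touched e := fun e i => by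
    simp [touched]
  have hmid : ∀ e i, G.midVar e i ∈ G.touched e := fun e i => by
    simp [touched]
  have havg : ∀ e, G.avgVar e ∈ G.touched e := fun e => by
    simp [touched]
  have h := sq_integral_prod_le pos hinj G.touched _ hK (fun e i hi => ?_)
    (fun e => N ^ G.cost pos e) (fun e => pow_nonneg hN0 _) ?_ Finset.univ (by simp) (fun _ => 1)
    continuous_const (fun _ _ _ _ => rfl)
  · simp only [one_mul, one_pow, integral_const, probReal_univ, smul_eq_mul, mul_one] at h
    rw [Finset.prod_pow_eq_pow_sum, Fintype.sum_prod_type] at h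
    have hsum : ∑ v, ∑ k, G.cost pos (v, k) ≤ 2 * (Fintype.card V + 2) := by
      calc _ ≤ ∑ v, (2 + (if v = s then 2 else 0) + (if v = t then 2 else 0)) :=
            Finset.sum_le_sum fun v _ => by
              obtain ⟨i, j, k, l, h1, h2, h3, h4, h5, h6⟩ := hpos.vertex v (Finset.mem_univ _)
              exact G.sum_cost_le pos v s t h1 h2 h3 h4 h5 h6
        _ = _ := by
            simp [Finset.sum_add_distrib, Finset.card_univ]
            ring
    refine abs_le_of_sq_le_sq (h.trans ?_) (pow_nonneg hN0 _)
    rw [← pow_mul, mul_comm]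
    exact pow_le_pow_right₀ hN hsum
  · refine Ignores.prod fun a _ => ignores_strand ?_ ?_ ?_
    · rintro rfl; exact hi (harg e a)
    · rintro rfl; exact hi (havg e)
    · rintro rfl; exact hi (hmid e _)
  · intro e f b hf hb hfi hbi
    have hξ : Function.Injective (G.argVar e) := fun i j h => by
      have := congrArg Prod.snd (Sum.inl.inj h)
      exact slot_injective _ _ this
    have hζ : Function.Injective fun i => G.midVar e (σ e i) := fun i j h => by
      have := congrArg Prod.snd (Sum.inr.inj h)
      exact (σ e).injective (Sum.inl.inj this)
    have hξζ : ∀ i j, G.argVar e i ≠ G.midVar e (σ e j) := fun i j => Sum.inl_ne_inr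
    have hξη : ∀ i, G.argVar e i ≠ G.avgVar e := fun i => Sum.inl_ne_inr
    have hζη : ∀ i, G.avgVar e ≠ G.midVar e (σ e i) := fun i h =>
      Sum.inr_ne_inl (congrArg Prod.snd (Sum.inr.inj h))
    have hfη : Ignores f (G.avgVar e) := hfi _ fun e' he' h => by
      rw [G.avgVar_mem_touched h] at he'
      exact lt_irrefl _ he'
    have hbη : Ignores b (G.avgVar e) := hbi _ (havg e) fun e' he' h => by
      rw [G.avgVar_mem_touched h] at he'
      exact lt_irrefl _ he'
    have hU : ∀ i, i ∈ newArgs (G.type e.1)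
        (Finset.univ.filter fun k => pos (e.1, k) < pos e) e.2 ↔
        ∀ k, pos (e.1, k) < pos e → ∀ j, slot (G.type e.1) k j ≠ slot (G.type e.1) e.2 i := by
      intro i
      simp [newArgs]
    -- `f` does not depend on the arguments of `e` that appear at `e` for the first time
    have hfU : ∀ i, i ∈ newArgs (G.type e.1)
        (Finset.univ.filter fun k => pos (e.1, k) < pos e) e.2 → Ignores f (G.argVar e i) := by
      intro i hi
      refine hfi _ fun e' he' h => ?_
      obtain ⟨h1, j, h2⟩ := (G.argVar_mem_touched).1 h
      exact (hU i).1 hi e'.2 (by rw [← h1]; exact he') j h2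
    -- `b` does not depend on the arguments of `e` that have appeared before `e`
    have hbU : ∀ i, i ∉ newArgs (G.type e.1)
        (Finset.univ.filter fun k => pos (e.1, k) < pos e) e.2 → Ignores b (G.argVar e i) := by
      intro i hi
      refine hbi _ (harg e i) fun e' he' h => ?_
      obtain ⟨h1, j, h2⟩ := (G.argVar_mem_touched).1 h
      rw [hU] at hi
      push Not at hi
      obtain ⟨k, hk, j', hj'⟩ := hi
      have hk' : k ≠ e.2 := by
        rintro rfl
        exact lt_irrefl _ hk
      have he'2 : e'.2 ≠ e.2 := fun h' => by
        rw [Prod.ext h1 h'] at he'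
        exact lt_irrefl _ he'
      have := eq_of_slot_eq _ _ _ _ _ _ _ hk' he'2 hj' h2
      rw [this, ← h1] at hk
      exact lt_asymm hk he'
    by_cases hout : pos e < pos (G.partner e)
    · have hfζ : ∀ i, Ignores f (G.midVar e (σ e i)) := fun i => hfi _ fun e' he' h => by
        rcases G.midVar_mem_touched h with rfl | rfl
        · exact lt_irrefl _ he'
        · exact lt_asymm he' hout
      have := hκ.sq_integral_mul_prod_le hN0 hξ hζ hξζ hξη hζη hf hb _ hfζ hfU hbη hbU
      simpa only [cost, hout, if_true] using this
    · have hbζ : ∀ i, Ignores b (G.midVar e (σ e i)) := fun i =>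
        hbi _ (hmid e _) fun e' he' h => by
          rcases G.midVar_mem_touched h with rfl | rfl
          · exact lt_irrefl _ he'
          · exact hout he'
      have := hκ.sq_integral_mul_prod_le hN0 hξ hζ hξζ hξη hζη hb hf
        (newArgs (G.type e.1) (Finset.univ.filter fun k => pos (e.1, k) < pos e) e.2)ᶜ hbζ
        (fun i hi => hbU i (Finset.mem_compl.1 hi)) hfη
        (fun i hi => hfU i (by simpa using hi))
      simp only [cost, hout, if_false]
      calc _ = _ := by simp_rw [mul_comm (f _)]
        _ ≤ _ := this
        _ = _ := by rw [mul_comm (∫ ω, b ω ^ 2)]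

end PowerCounting

/-! ### Matrix elements of the irreducible representations -/

section SpinMatrix

open Polynomial

theorem aeval_homogenize_eq_sum {m : ℕ} {p : ℂ[X]} (hp : p.natDegree ≤ m) (u v : ℂ[X]) :
    MvPolynomial.aeval ![u, v] (p.homogenize m) =
      ∑ k : Fin (m + 1), C (p.coeff k) * (u ^ (k : ℕ) * v ^ (m - k)) := by
  conv_lhs => rw [p.as_sum_range_C_mul_X_pow' (Nat.lt_succ_of_le hp)]
  rw [homogenize_finsetSum, map_sum, Finset.sum_range]
  refine Finset.sum_congr rfl fun k _ => ?_
  rw [homogenize_C_mul, homogenize_X_pow (Nat.le_of_lt_succ k.2)]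
  simp

theorem natDegree_linear_pow_le (a b : ℂ) (n : ℕ) : ((C a * X + C b) ^ n).natDegree ≤ n := by
  have := natDegree_pow_le_of_le n (natDegree_linear_le (a := a) (b := b))
  simpa using this

theorem aeval_homogenize_linear_pow (a b : ℂ) (n : ℕ) (u v : ℂ[X]) :
    MvPolynomial.aeval ![u, v] (((C a * X + C b) ^ n).homogenize n) = (C a * u + C b * v) ^ n := by
  have h := homogenize_finsetProd (s := Finset.range n) (p := fun _ => C a * X + C b)
    (n := fun _ => 1) fun _ _ => natDegree_linear_le
  simp only [Finset.prod_const, Finset.card_range, Finset.sum_const, smul_eq_mul, mul_one] at h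
  rw [h, map_pow]
  congr 1
  rw [homogenize_add, homogenize_C_mul, homogenize_X one_ne_zero, homogenize_C]
  simp

theorem spinMatrix_mul (m : ℕ) (g h : SU2) :
    spinMatrix m (g * h) = spinMatrix m g * spinMatrix m h := by
  ext a b
  set u : ℂ[X] := C (g.1 0 0) * X + C (g.1 1 0) with hu
  set v : ℂ[X] := C (g.1 0 1) * X + C (g.1 1 1) with hv
  have hb : (b : ℕ) + (m - b) = m := by omega
  have h1 : (C (h.1 0 0) * u + C (h.1 1 0) * v) ^ (b : ℕ) *
      (C (h.1 0 1) * u + C (h.1 1 1) * v) ^ (m - (b : ℕ)) =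
      ∑ k : Fin (m + 1), C (spinMatrix m h k b) * (u ^ (k : ℕ) * v ^ (m - k)) := by
    have h2 := homogenize_mul _ _ (natDegree_linear_pow_le (h.1 0 0) (h.1 1 0) b)
      (natDegree_linear_pow_le (h.1 0 1) (h.1 1 1) (m - b))
    rw [hb] at h2
    have h3 := congrArg (MvPolynomial.aeval ![u, v]) h2
    rw [map_mul, aeval_homogenize_linear_pow, aeval_homogenize_linear_pow,
      aeval_homogenize_eq_sum] at h3
    · exact h3.symm
    · refine natDegree_mul_le.trans ?_
      calc _ ≤ (b : ℕ) + (m - b) :=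
            add_le_add (natDegree_linear_pow_le _ _ _) (natDegree_linear_pow_le _ _ _)
        _ = m := hb
  have h4 : ∀ j : Fin 2, C ((g * h).1 0 j) * X + C ((g * h).1 1 j) =
      C (h.1 0 j) * u + C (h.1 1 j) * v := by
    intro j
    rw [show (g * h).1 = g.1 * h.1 from rfl]
    simp only [Matrix.mul_apply, Fin.sum_univ_two, C_add, C_mul, hu, hv]
    ring
  rw [Matrix.mul_apply]
  unfold spinMatrix
  rw [h4 0, h4 1, h1, finsetSum_coeff]
  refine Finset.sum_congr rfl fun k _ => ?_
  rw [coeff_C_mul, mul_comm]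
  rfl

/-- The element of `SU(2)` which conjugates every element of `SU(2)` to its complex conjugate. -/
def conjugator : SU2 :=
  ⟨!![0, -1; 1, 0], by
    rw [Matrix.mem_specialUnitaryGroup_iff, Matrix.mem_unitaryGroup_iff]
    constructor
    · ext i j
      fin_cases i <;> fin_cases j <;> simp [Matrix.mul_apply, Fin.sum_univ_two, Matrix.star_apply]
    · simp [Matrix.det_fin_two]⟩

theorem star_eq_adjugate (g : SU2) : star g.1 = g.1.adjugate := by
  have h1 : star g.1 * g.1 = 1 :=
    Matrix.mem_unitaryGroup_iff'.1 (Matrix.mem_specialUnitaryGroup_iff.1 g.2).1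
  have h2 : g.1 * g.1.adjugate = 1 := by
    rw [Matrix.mul_adjugate, (Matrix.mem_specialUnitaryGroup_iff.1 g.2).2, one_smul]
  calc star g.1 = star g.1 * (g.1 * g.1.adjugate) := by rw [h2, mul_one]
    _ = g.1.adjugate := by rw [← mul_assoc, h1, one_mul]

theorem conjugator_mul_mul_inv (g : SU2) (i j : Fin 2) :
    (conjugator * g * conjugator⁻¹).1 i j = starRingEnd ℂ (g.1 i j) := by
  have h := star_eq_adjugate g
  rw [Matrix.adjugate_fin_two] at h
  have h' : ∀ i j, starRingEnd ℂ (g.1 i j) = (!![g.1 1 1, -g.1 0 1; -g.1 1 0, g.1 0 0]) j i := by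
    intro i j
    rw [← h]
    rfl
  rw [h', show (conjugator * g * conjugator⁻¹).1 = conjugator.1 * g.1 * star conjugator.1 from rfl]
  fin_cases i <;> fin_cases j <;>
    simp [conjugator, Matrix.mul_apply, Matrix.vecMul, dotProduct, Fin.sum_univ_two,
      Matrix.star_apply]

theorem conj_spinMatrix (m : ℕ) (g : SU2) (a b : Fin (m + 1)) :
    starRingEnd ℂ (spinMatrix m g a b) = spinMatrix m (conjugator * g * conjugator⁻¹) a b := by
  unfold spinMatrix
  rw [← coeff_map]
  simp [conjugator_mul_mul_inv, Polynomial.map_mul, Polynomial.map_pow]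

end SpinMatrix

/-! ### The truncated space of functions on `SU(2)` and its reproducing kernel -/

/-- Labels of the matrix elements of spin at most `M / 2`. -/
abbrev SpinIndex (M : ℕ) : Type := (m : Fin (M + 1)) × (Fin (m + 1) × Fin (m + 1))

/-- The matrix element of label `p`, as a function on `SU(2)`. -/
noncomputable def spinElement {M : ℕ} (p : SpinIndex M) (g : SU2) : ℂ :=
  spinMatrix p.1 g p.2.1 p.2.2

/-- Complex functions on `SU(2)` whose Peter-Weyl expansion only involves spins at most `M / 2`. -/
noncomputable def spinSpan (M : ℕ) : Submodule ℂ (SU2 → ℂ) :=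
  Submodule.span ℂ (Set.range (spinElement (M := M)))

/-- Real functions on `SU(2)` whose Peter-Weyl expansion only involves spins at most `M / 2`. -/
noncomputable def realSpinSpan (M : ℕ) : Submodule ℝ (SU2 → ℝ) :=
  ((spinSpan M).restrictScalars ℝ).comap (Complex.ofRealCLM.toLinearMap.compLeft SU2)

theorem mem_realSpinSpan {M : ℕ} {φ : SU2 → ℝ} :
    φ ∈ realSpinSpan M ↔ (fun g => (φ g : ℂ)) ∈ spinSpan M := Iff.rfl

theorem continuous_of_mem_spinSpan {M : ℕ} {f : SU2 → ℂ} (hf : f ∈ spinSpan M) :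
    Continuous f := by
  induction hf using Submodule.span_induction with
  | mem f hf =>
    obtain ⟨p, rfl⟩ := hf
    exact continuous_spinMatrix _ _ _
  | zero => exact continuous_const
  | add f g _ _ hf hg => exact hf.add hg
  | smul c f _ hf => exact hf.const_smul c

theorem continuous_of_mem_realSpinSpan {M : ℕ} {φ : SU2 → ℝ} (hφ : φ ∈ realSpinSpan M) :
    Continuous φ :=
  Complex.continuous_re.comp (continuous_of_mem_spinSpan (mem_realSpinSpan.1 hφ))

theorem spinElement_mem {M : ℕ} (p : SpinIndex M) : spinElement p ∈ spinSpan M :=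
  Submodule.subset_span ⟨p, rfl⟩

theorem mul_right_mem_spinSpan {M : ℕ} {f : SU2 → ℂ} (hf : f ∈ spinSpan M) (h : SU2) :
    (fun g => f (g * h)) ∈ spinSpan M := by
  induction hf using Submodule.span_induction with
  | mem f hf =>
    obtain ⟨⟨m, a, b⟩, rfl⟩ := hf
    have : (fun g => spinElement (⟨m, a, b⟩ : SpinIndex M) (g * h)) =
        ∑ c, spinMatrix m h c b • spinElement (⟨m, a, c⟩ : SpinIndex M) := by
      ext g
      simp [spinElement, spinMatrix_mul, Matrix.mul_apply, mul_comm]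
    rw [this]
    exact Submodule.sum_mem _ fun c _ => Submodule.smul_mem _ _ (spinElement_mem _)
  | zero => exact Submodule.zero_mem _
  | add f g _ _ hf hg => exact Submodule.add_mem _ hf hg
  | smul c f _ hf => exact Submodule.smul_mem _ c hf

theorem conj_mem_spinSpan {M : ℕ} {f : SU2 → ℂ} (hf : f ∈ spinSpan M) :
    (fun g => starRingEnd ℂ (f g)) ∈ spinSpan M := by
  induction hf using Submodule.span_induction with
  | mem f hf =>
    obtain ⟨⟨m, a, b⟩, rfl⟩ := hf
    have : (fun g => starRingEnd ℂ (spinElement (⟨m, a, b⟩ : SpinIndex M) g)) =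
        ∑ d, ∑ c, (spinMatrix m conjugator a c * spinMatrix m conjugator⁻¹ d b) •
          spinElement (⟨m, c, d⟩ : SpinIndex M) := by
      ext g
      simp only [spinElement, conj_spinMatrix, spinMatrix_mul, Matrix.mul_apply, Finset.sum_mul,
        Finset.sum_apply, Pi.smul_apply, smul_eq_mul]
      exact Finset.sum_congr rfl fun d _ => Finset.sum_congr rfl fun c _ => by ring
    rw [this]
    exact Submodule.sum_mem _ fun d _ => Submodule.sum_mem _ fun c _ =>
      Submodule.smul_mem _ _ (spinElement_mem _)
  | zero =>
    convert Submodule.zero_mem (spinSpan M) using 1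
    ext g
    simp
  | add f g _ _ hf hg =>
    convert Submodule.add_mem _ hf hg using 1
    ext g
    simp
  | smul c f _ hf =>
    convert Submodule.smul_mem _ (starRingEnd ℂ c) hf using 1
    ext g
    simp

theorem re_mem_realSpinSpan {M : ℕ} {f : SU2 → ℂ} (hf : f ∈ spinSpan M) :
    (fun g => (f g).re) ∈ realSpinSpan M := by
  rw [mem_realSpinSpan]
  have : (fun g => ((f g).re : ℂ)) = (1 / 2 : ℂ) • (f + fun g => starRingEnd ℂ (f g)) := by
    ext g
    simp only [Pi.smul_apply, Pi.add_apply, Complex.add_conj, smul_eq_mul]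
    push_cast
    ring
  rw [this]
  exact Submodule.smul_mem _ _ (Submodule.add_mem _ hf (conj_mem_spinSpan hf))

theorem im_mem_realSpinSpan {M : ℕ} {f : SU2 → ℂ} (hf : f ∈ spinSpan M) :
    (fun g => (f g).im) ∈ realSpinSpan M := by
  have := re_mem_realSpinSpan (Submodule.smul_mem _ (-Complex.I) hf)
  simpa using this

theorem mul_right_mem_realSpinSpan {M : ℕ} {φ : SU2 → ℝ} (hφ : φ ∈ realSpinSpan M) (h : SU2) :
    (fun g => φ (g * h)) ∈ realSpinSpan M :=
  mem_realSpinSpan.2 (mul_right_mem_spinSpan (mem_realSpinSpan.1 hφ) h)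

instance (M : ℕ) : FiniteDimensional ℂ (spinSpan M) :=
  FiniteDimensional.span_of_finite ℂ (Set.finite_range _)

theorem finrank_spinSpan_le (M : ℕ) : Module.finrank ℂ (spinSpan M) ≤ (M + 1) ^ 3 := by
  refine (finrank_range_le_card _).trans ?_
  rw [Fintype.card_sigma]
  calc _ ≤ ∑ m : Fin (M + 1), (M + 1) * (M + 1) := Finset.sum_le_sum fun m _ => by
        have := m.2
        simp only [Fintype.card_prod, Fintype.card_fin]
        exact Nat.mul_le_mul (by omega) (by omega)
    _ = _ := by simp; ring

instance (M : ℕ) : FiniteDimensional ℝ (spinSpan M) := FiniteDimensional.complexToReal _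

/-- The inclusion of the real functions in the complex ones. -/
noncomputable def realSpinSpanIncl (M : ℕ) : realSpinSpan M →ₗ[ℝ] (spinSpan M).restrictScalars ℝ :=
  (Complex.ofRealCLM.toLinearMap.compLeft SU2).restrict fun _ h => h

theorem realSpinSpanIncl_injective (M : ℕ) : Function.Injective (realSpinSpanIncl M) := by
  intro x y hxy
  ext g
  exact Complex.ofReal_injective (congrFun (congrArg Subtype.val hxy) g)

instance (M : ℕ) : FiniteDimensional ℝ (realSpinSpan M) := by
  have : FiniteDimensional ℝ ((spinSpan M).restrictScalars ℝ) :=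
    inferInstanceAs (FiniteDimensional ℝ (spinSpan M))
  exact FiniteDimensional.of_injective _ (realSpinSpanIncl_injective M)

theorem finrank_realSpinSpan_le (M : ℕ) :
    Module.finrank ℝ (realSpinSpan M) ≤ 2 * (M + 1) ^ 3 := by
  have : FiniteDimensional ℝ ((spinSpan M).restrictScalars ℝ) :=
    inferInstanceAs (FiniteDimensional ℝ (spinSpan M))
  calc _ ≤ Module.finrank ℝ ((spinSpan M).restrictScalars ℝ) :=
        LinearMap.finrank_le_finrank_of_injective (realSpinSpanIncl_injective M)
    _ = 2 * Module.finrank ℂ (spinSpan M) := finrank_real_of_complex (spinSpan M)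
    _ ≤ _ := Nat.mul_le_mul_left _ (finrank_spinSpan_le M)

theorem exists_orthonormal_basis {X : Type*} [TopologicalSpace X] [CompactSpace X]
    [MeasurableSpace X] [OpensMeasurableSpace X] (μ : Measure X) [IsFiniteMeasure μ]
    [μ.IsOpenPosMeasure] (U : Submodule ℝ (X → ℝ)) [FiniteDimensional ℝ U]
    (hU : ∀ f ∈ U, Continuous f) :
    ∃ e : Fin (Module.finrank ℝ U) → X → ℝ, (∀ i, e i ∈ U) ∧
      (∀ i j, ∫ x, e i x * e j x ∂μ = if i = j then 1 else 0) ∧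
      ∀ f ∈ U, ∀ x, f x = ∑ i, (∫ y, e i y * f y ∂μ) * e i x := by
  have hint : ∀ f g : U, Integrable (fun x => f.1 x * g.1 x) μ := fun f g =>
    integrable_of_compact ((hU f.1 f.2).mul (hU g.1 g.2))
  let core : InnerProductSpace.Core ℝ U :=
    { inner := fun f g => ∫ x, f.1 x * g.1 x ∂μ
      conj_inner_symm := fun f g => by simp [mul_comm]
      re_inner_nonneg := fun f => integral_nonneg fun x => mul_self_nonneg _
      add_left := fun f g h => by
        simp only [Submodule.coe_add, Pi.add_apply, add_mul]
        exact integral_add (hint f h) (hint g h)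
      smul_left := fun f g r => by
        simp [mul_assoc, integral_const_mul]
      definite := fun f hf => by
        have hc := hU f.1 f.2
        have h0 : ∫ x, f.1 x * f.1 x ∂μ = 0 := hf
        rw [integral_eq_zero_iff_of_nonneg (fun x => mul_self_nonneg _) (hint f f)] at h0
        have h1 := (Continuous.ae_eq_iff_eq μ (hc.mul hc) continuous_const).1 h0
        ext x
        exact mul_self_eq_zero.1 (congrFun h1 x) }
  let _ : NormedAddCommGroup U := core.toNormedAddCommGroup
  let _ : InnerProductSpace ℝ U := InnerProductSpace.ofCore core.toCore
  have hinner : ∀ f g : U, inner ℝ f g = ∫ x, f.1 x * g.1 x ∂μ := fun f g => rfl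
  let b := stdOrthonormalBasis ℝ U
  refine ⟨fun i => (b i).1, fun i => (b i).2, fun i j => ?_, fun f hf x => ?_⟩
  · rw [← hinner]
    exact orthonormal_iff_ite.1 b.orthonormal i j
  · have h1 := b.sum_repr' ⟨f, hf⟩
    have h2 := congrFun (congrArg Subtype.val h1) x
    simp only [Submodule.coe_sum, Submodule.coe_smul, Finset.sum_apply, Pi.smul_apply,
      smul_eq_mul, hinner] at h2
    exact h2.symm

/-- The properties of the reproducing kernel `κ` of the space of functions of spin at most `M / 2`
that identify the covariance. -/
structure IsReproducing (M : ℕ) (κ : SU2 → SU2 → ℝ) : Prop where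
  symm : ∀ x y, κ x y = κ y x
  mem : ∀ x, κ x ∈ realSpinSpan M
  sep : ∃ (d : ℕ) (e : Fin d → SU2 → ℝ), (∀ i, e i ∈ realSpinSpan M) ∧
    ∀ x y, κ x y = ∑ i, e i x * e i y
  repr : ∀ φ ∈ realSpinSpan M, ∀ x, ∫ y, κ x y * φ y = φ x

theorem exists_kernel (M : ℕ) :
    ∃ κ : SU2 → SU2 → ℝ, IsReproducing M κ ∧ StrandKernel (2 * ((M : ℝ) + 1) ^ 3) κ := by
  obtain ⟨e, he, horth, hrep⟩ := exists_orthonormal_basis (volume : Measure SU2) (realSpinSpan M)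
    fun f hf => continuous_of_mem_realSpinSpan hf
  have hec : ∀ i, Continuous (e i) := fun i => continuous_of_mem_realSpinSpan (he i)
  let κ : SU2 → SU2 → ℝ := fun x y => ∑ i, e i x * e i y
  have hκ : ∀ x y, κ x y = ∑ i, e i x * e i y := fun _ _ => rfl
  have hsymm : ∀ x y, κ x y = κ y x := fun x y => by simp [hκ, mul_comm]
  have hmem : ∀ x, κ x ∈ realSpinSpan M := fun x => by
    have : κ x = ∑ i, e i x • e i := by
      ext y
      simp [hκ]
    rw [this]
    exact Submodule.sum_mem _ fun i _ => Submodule.smul_mem _ _ (he i)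
  have hκc : Continuous fun p : SU2 × SU2 => κ p.1 p.2 :=
    continuous_finsetSum _ fun i _ =>
      ((hec i).comp continuous_fst).mul ((hec i).comp continuous_snd)
  have hpair : ∀ β : SU2 → ℝ, Continuous β → ∀ y,
      ∫ x, β x * κ x y = ∑ i, (∫ x, e i x * β x) * e i y := by
    intro β hβ y
    simp_rw [hκ, Finset.mul_sum]
    rw [integral_finsetSum]
    · refine Finset.sum_congr rfl fun i _ => ?_
      rw [← integral_mul_const]
      exact integral_congr_ae (.of_forall fun x => by ring)
    · exact fun i _ => integrable_of_compact (hβ.mul ((hec i).mul continuous_const))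
  have hrepr : ∀ φ ∈ realSpinSpan M, ∀ x, ∫ y, κ x y * φ y = φ x := by
    intro φ hφ x
    rw [hrep φ hφ x, ← hpair φ (continuous_of_mem_realSpinSpan hφ) x]
    exact integral_congr_ae (.of_forall fun y => by simp only [hsymm x y]; ring)
  have hright : ∀ x y h, κ (x * h) (y * h) = κ x y := by
    intro x y h
    have h1 : (fun z => κ (z * h) (y * h)) ∈ realSpinSpan M := by
      have := mul_right_mem_realSpinSpan (hmem (y * h)) h
      simpa only [hsymm _ (y * h)] using this
    have h2 : (fun z => κ x (z * h⁻¹)) ∈ realSpinSpan M := mul_right_mem_realSpinSpan (hmem x) h⁻¹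
    calc κ (x * h) (y * h) = ∫ z, κ x z * κ (z * h) (y * h) := (hrepr _ h1 x).symm
      _ = ∫ z, κ x (z * h⁻¹) * κ z (y * h) := by
        rw [← integral_mul_right_eq_self (fun z => κ x (z * h⁻¹) * κ z (y * h)) h]
        simp
      _ = ∫ z, κ (y * h) z * κ x (z * h⁻¹) :=
        integral_congr_ae (.of_forall fun z => by simp only [hsymm z (y * h)]; ring)
      _ = κ x (y * h * h⁻¹) := hrepr _ h2 _
      _ = κ x y := by rw [mul_inv_cancel_right]
  have hdiag : ∀ y, ∫ x, κ x y ^ 2 = Module.finrank ℝ (realSpinSpan M) := by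
    intro y
    have h1 : ∀ z, ∫ x, κ x z ^ 2 = κ z z := fun z => by
      rw [← hrepr _ (hmem z) z]
      exact integral_congr_ae (.of_forall fun x => by simp only [hsymm x z]; ring)
    have h2 : ∀ z, κ z z = κ y y := fun z => by
      rw [← hright z z (z⁻¹ * y), mul_inv_cancel_left]
    have h3 : ∫ z, κ z z = κ y y := by simp [h2]
    rw [h1, ← h3]
    simp_rw [hκ]
    rw [integral_finsetSum]
    · simp [horth]
    · exact fun i _ => integrable_of_compact ((hec i).mul (hec i))
  refine ⟨κ, ⟨hsymm, hmem, ⟨_, e, he, hκ⟩, hrepr⟩, hκc, hright, fun y => ?_, fun β hβ => ?_⟩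
  · rw [hdiag]
    exact_mod_cast finrank_realSpinSpan_le M
  · simp_rw [hpair β hβ]
    -- Bessel's inequality
    set c : Fin (Module.finrank ℝ (realSpinSpan M)) → ℝ := fun i => ∫ x, e i x * β x
    have hsq : ∫ y, (∑ i, c i * e i y) ^ 2 = ∑ i, c i ^ 2 := by
      simp_rw [pow_two, Finset.sum_mul_sum]
      rw [integral_finsetSum]
      · refine Finset.sum_congr rfl fun i _ => ?_
        rw [integral_finsetSum]
        · calc _ = ∑ j, c i * c j * ∫ y, e i y * e j y := Finset.sum_congr rfl fun j _ => by
                rw [← integral_const_mul]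
                exact integral_congr_ae (.of_forall fun y => by ring)
            _ = _ := by simp [horth]
        · exact fun j _ => integrable_of_compact (by
            have := hec i; have := hec j; fun_prop)
      · exact fun i _ => integrable_of_compact (continuous_finsetSum _ fun j _ => by
            have := hec i; have := hec j; fun_prop)
    have hcross : ∫ y, β y * ∑ i, c i * e i y = ∑ i, c i ^ 2 := by
      simp_rw [Finset.mul_sum]
      rw [integral_finsetSum]
      · refine Finset.sum_congr rfl fun i _ => ?_
        rw [pow_two, ← integral_const_mul]
        exact integral_congr_ae (.of_forall fun y => by ring)
      · exact fun i _ => integrable_of_compact (by have := hec i; fun_prop)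
    have hS : Continuous fun y => ∑ i, c i * e i y :=
      continuous_finsetSum _ fun i _ => continuous_const.mul (hec i)
    have h0 : 0 ≤ ∫ y, (β y - ∑ i, c i * e i y) ^ 2 := integral_nonneg fun y => sq_nonneg _
    have h1 : ∫ y, (β y - ∑ i, c i * e i y) ^ 2 =
        (∫ y, β y ^ 2) - 2 * (∫ y, β y * ∑ i, c i * e i y) + ∫ y, (∑ i, c i * e i y) ^ 2 := by
      rw [← integral_const_mul, ← integral_sub, ← integral_add]
      · exact integral_congr_ae (.of_forall fun y => by ring)
      all_goals exact integrable_of_compact (by fun_prop)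
    rw [h1, hcross, hsq] at h0
    rw [hsq]
    linarith

/-- The kernel also reproduces the complex functions of the truncated space. -/
theorem IsReproducing.repr_complex {M : ℕ} {κ : SU2 → SU2 → ℝ} (hκ : IsReproducing M κ)
    {f : SU2 → ℂ} (hf : f ∈ spinSpan M) (x : SU2) : ∫ y, (κ x y : ℂ) * f y = f x := by
  have hc := continuous_of_mem_realSpinSpan (hκ.mem x)
  have hfc := continuous_of_mem_spinSpan hf
  have h1 : ∀ y, (κ x y : ℂ) * f y =
      ((κ x y * (f y).re : ℝ) : ℂ) + ((κ x y * (f y).im : ℝ) : ℂ) * Complex.I := fun y => by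
    conv_lhs => rw [← Complex.re_add_im (f y)]
    push_cast
    ring
  simp_rw [h1]
  rw [integral_add, integral_mul_const, integral_complex_ofReal, integral_complex_ofReal,
    hκ.repr _ (re_mem_realSpinSpan hf), hκ.repr _ (im_mem_realSpinSpan hf), Complex.re_add_im]
  all_goals exact integrable_of_compact (by fun_prop)

/-! ### Factorization of the covariance -/

theorem prod_mem_truncatedComplex {M : ℕ} {Λ : ℝ} (hM : (M : ℝ) / 2 ≤ Λ) {f : Fin 3 → SU2 → ℂ}
    (hf : ∀ i, f i ∈ spinSpan M) : (fun g => ∏ i, f i (g i)) ∈ truncatedComplex Λ := by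
  choose c hc using fun i => (Submodule.mem_span_range_iff_exists_fun ℂ).1 (hf i)
  have : (fun g : Fin 3 → SU2 => ∏ i, f i (g i)) = ∑ J : Fin 3 → SpinIndex M,
      (∏ i, c i (J i)) • matrixCoeff (fun i => (J i).1) (fun i => (J i).2.1)
        (fun i => (J i).2.2) := by
    ext g
    simp_rw [← hc]
    simp only [Finset.sum_apply, Pi.smul_apply, smul_eq_mul, Finset.prod_univ_sum,
      Fintype.piFinset_univ, matrixCoeff, ← Finset.prod_mul_distrib, spinElement]
  rw [this]
  refine Submodule.sum_mem _ fun J _ => Submodule.smul_mem _ _ (Submodule.subset_span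
    ⟨_, fun i => ?_, _, _, rfl⟩)
  have : (((J i).1 : ℕ) : ℝ) ≤ M := by exact_mod_cast Nat.lt_succ_iff.1 (J i).1.2
  linarith

theorem prod_mem_truncated {M : ℕ} {Λ : ℝ} (hM : (M : ℝ) / 2 ≤ Λ) {f : Fin 3 → SU2 → ℝ}
    (hf : ∀ i, f i ∈ realSpinSpan M) : (fun g => ∏ i, f i (g i)) ∈ truncated Λ := by
  have h := prod_mem_truncatedComplex hM fun i => mem_realSpinSpan.1 (hf i)
  have h2 : (fun g : Fin 3 → SU2 => ((∏ i, f i (g i) : ℝ) : ℂ)) ∈ truncatedComplex Λ := by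
    simpa using h
  exact h2

/-- The triple product of `κ` is the reproducing kernel of the truncated space of fields. -/
theorem IsReproducing.repr_field {Λ : ℝ} {κ : SU2 → SU2 → ℝ} (hκ : IsReproducing ⌊2 * Λ⌋₊ κ)
    {φ : (Fin 3 → SU2) → ℝ} (hφ : φ ∈ truncated Λ) (x : Fin 3 → SU2) :
    ∫ y, (∏ i, κ (x i) (y i)) * φ y = φ x := by
  have hc : ∀ x, Continuous (κ x) := fun x => continuous_of_mem_realSpinSpan (hκ.mem x)
  have key : ∀ f ∈ truncatedComplex Λ, Continuous f ∧
      ∫ y : Fin 3 → SU2, ((∏ i, κ (x i) (y i) : ℝ) : ℂ) * f y = f x := by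
    intro f hf
    have hcont : Continuous fun y : Fin 3 → SU2 => ((∏ i, κ (x i) (y i) : ℝ) : ℂ) :=
      Complex.continuous_ofReal.comp (continuous_finsetProd _ fun i _ =>
        (hc (x i)).comp (continuous_apply i))
    induction hf using Submodule.span_induction with
    | mem f hf =>
      obtain ⟨m, hm, a, b, rfl⟩ := hf
      refine ⟨continuous_finsetProd _ fun i _ =>
        (continuous_spinMatrix _ _ _).comp (continuous_apply i), ?_⟩
      simp only [matrixCoeff, Complex.ofReal_prod, ← Finset.prod_mul_distrib]
      rw [integral_fintype_prod_volume_eq_prod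
        (fun i z => (κ (x i) z : ℂ) * spinMatrix (m i) z (a i) (b i))]
      refine Finset.prod_congr rfl fun i _ => hκ.repr_complex ?_ (x i)
      have hmi : m i ≤ ⌊2 * Λ⌋₊ := Nat.le_floor (by have := hm i; linarith)
      exact spinElement_mem (⟨⟨m i, Nat.lt_succ_of_le hmi⟩, a i, b i⟩ : SpinIndex ⌊2 * Λ⌋₊)
    | zero => exact ⟨continuous_const, by simp⟩
    | add f g _ _ hf hg =>
      refine ⟨hf.1.add hg.1, ?_⟩
      have h := integral_add (μ := volume) (integrable_of_compact (hcont.mul hf.1))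
        (integrable_of_compact (hcont.mul hg.1))
      simp only [Pi.mul_apply] at h
      simp only [Pi.add_apply, mul_add]
      rw [h, hf.2, hg.2]
    | smul c f _ hf =>
      refine ⟨hf.1.const_smul c, ?_⟩
      simp only [Pi.smul_apply, smul_eq_mul, mul_left_comm _ c]
      rw [integral_const_mul, hf.2]
  have h := (key _ hφ).2
  apply Complex.ofReal_injective
  rw [← integral_complex_ofReal]
  push_cast
  simpa using h

theorem integral_swap_of_continuous {X Y : Type*} [TopologicalSpace X] [CompactSpace X]
    [SecondCountableTopology X] [MeasurableSpace X] [BorelSpace X]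
    [TopologicalSpace Y] [CompactSpace Y] [SecondCountableTopology Y]
    [MeasurableSpace Y] [BorelSpace Y] (μ : Measure X) [IsFiniteMeasure μ]
    (ν : Measure Y) [IsFiniteMeasure ν] {F : X → Y → ℝ}
    (hF : Continuous fun p : X × Y => F p.1 p.2) :
    ∫ x, ∫ y, F x y ∂ν ∂μ = ∫ y, ∫ x, F x y ∂μ ∂ν :=
  integral_integral_swap (integrable_of_compact hF)

/-- The covariance averages the reproducing kernel of the fields over the cyclic permutations and
over the right diagonal action. -/
theorem covarianceKernel_eq {N Λ : ℝ} (hΛ : 0 ≤ Λ) {κ : SU2 → SU2 → ℝ}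
    (hκ : IsReproducing ⌊2 * Λ⌋₊ κ) (hκ' : StrandKernel N κ) (x y : Fin 3 → SU2) :
    covarianceKernel Λ x y = (1 / 3) * ∑ c : Fin 3, ∫ h, ∏ i, κ (x (i + c) * h) (y i) := by
  have hM : ((⌊2 * Λ⌋₊ : ℕ) : ℝ) / 2 ≤ Λ := by
    have := Nat.floor_le (show 0 ≤ 2 * Λ by positivity)
    linarith
  have hk := hκ'.cont
  have hcont : ∀ (x : Fin 3 → SU2) (c : Fin 3), Continuous fun p : SU2 × (Fin 3 → SU2) =>
      ∏ i, κ (x (i + c) * p.1) (p.2 i) := fun x c => continuous_finsetProd _ fun i _ => by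
    have : Continuous fun p : SU2 × (Fin 3 → SU2) => (x (i + c) * p.1, p.2 i) := by fun_prop
    exact hk.comp this
  have hspec : IsCovarianceKernel Λ fun x y =>
      (1 / 3) * ∑ c : Fin 3, ∫ h, ∏ i, κ (x (i + c) * h) (y i) := by
    refine ⟨fun x => ?_, fun φ hφ x => ?_⟩
    · obtain ⟨d, e, he, hsep⟩ := hκ.sep
      have hec : ∀ k, Continuous (e k) := fun k => continuous_of_mem_realSpinSpan (he k)
      have : (fun y : Fin 3 → SU2 =>
          (1 / 3) * ∑ c : Fin 3, ∫ h, ∏ i, κ (x (i + c) * h) (y i)) =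
          (1 / 3 : ℝ) • ∑ c : Fin 3, ∑ J : Fin 3 → Fin d,
            (∫ h, ∏ i, e (J i) (x (i + c) * h)) • fun y : Fin 3 → SU2 => ∏ i, e (J i) (y i) := by
        ext y
        simp only [hsep, Pi.smul_apply, Finset.sum_apply, smul_eq_mul, Finset.prod_univ_sum,
          Fintype.piFinset_univ, Finset.prod_mul_distrib]
        congr 1
        refine Finset.sum_congr rfl fun c _ => ?_
        rw [integral_finsetSum]
        · exact Finset.sum_congr rfl fun J _ => integral_mul_const _ _
        · exact fun J _ => integrable_of_compact ((continuous_finsetProd _ fun i _ =>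
            (hec _).comp (continuous_const_mul _)).mul continuous_const)
      change (fun y : Fin 3 → SU2 => _) ∈ truncated Λ
      rw [this]
      exact Submodule.smul_mem _ _ (Submodule.sum_mem _ fun c _ => Submodule.sum_mem _ fun J _ =>
        Submodule.smul_mem _ _ (prod_mem_truncated hM fun i => he (J i)))
    · have hφc := continuous_of_mem_truncated hφ
      have hF : ∀ c, Continuous fun p : (Fin 3 → SU2) × SU2 =>
          (∏ i, κ (x (i + c) * p.2) (p.1 i)) * φ p.1 := fun c =>
        ((hcont x c).comp continuous_swap).mul (hφc.comp continuous_fst)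
      have hI : ∀ c, Continuous fun y : Fin 3 → SU2 =>
          (∫ h, ∏ i, κ (x (i + c) * h) (y i)) * φ y := fun c => by
        have h := continuous_parametric_integral_of_continuous (μ := (volume : Measure SU2))
          (f := fun (y : Fin 3 → SU2) h => ∏ i, κ (x (i + c) * h) (y i))
          ((hcont x c).comp continuous_swap) isCompact_univ
        rw [Measure.restrict_univ] at h
        exact h.mul hφc
      simp only [symmetrizer, mul_assoc, Finset.sum_mul]
      rw [integral_const_mul, integral_finsetSum _ fun c _ => integrable_of_compact (hI c)]
      congr 1
      refine Finset.sum_congr rfl fun c _ => ?_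
      calc _ = ∫ y, ∫ h, (∏ i, κ (x (i + c) * h) (y i)) * φ y := by
            simp_rw [integral_mul_const]
        _ = ∫ h, ∫ y, (∏ i, κ (x (i + c) * h) (y i)) * φ y :=
            integral_swap_of_continuous volume volume (hF c)
        _ = _ := by
            refine integral_congr_ae (.of_forall fun h => ?_)
            exact hκ.repr_field hφ fun i => x (i + c) * h
  exact congrFun (congrFun ((existsUnique_covarianceKernel Λ).unique (covarianceKernel_spec Λ)
    hspec) x) y

/-- The average over the right diagonal action, split by a point inserted in the middle of the line;
the variables are the three arguments of this point and the group elements at the two ends. -/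
theorem integral_prod_kernel_eq {M : ℕ} {N : ℝ} {κ : SU2 → SU2 → ℝ}
    (hκ : IsReproducing M κ) (hκ' : StrandKernel N κ) (x y : Fin 3 → SU2) :
    ∫ h, ∏ i, κ (x i * h) (y i) = ∫ u : Fin 3 ⊕ Fin 2 → SU2,
      (∏ i, κ (x i * u (.inr 0)) (u (.inl i))) * ∏ i, κ (y i * u (.inr 1)) (u (.inl i)) := by
  have hk := hκ'.cont
  let F : (Fin 3 → SU2) → (Fin 2 → SU2) → ℝ := fun z w =>
    (∏ i, κ (x i * w 0) (z i)) * ∏ i, κ (y i * w 1) (z i)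
  have hF : Continuous fun p : (Fin 3 → SU2) × (Fin 2 → SU2) => F p.1 p.2 := by
    refine (continuous_finsetProd _ fun i _ => ?_).mul (continuous_finsetProd _ fun i _ => ?_)
    · have : Continuous fun p : (Fin 3 → SU2) × (Fin 2 → SU2) => (x i * p.2 0, p.1 i) := by fun_prop
      exact hk.comp this
    · have : Continuous fun p : (Fin 3 → SU2) × (Fin 2 → SU2) => (y i * p.2 1, p.1 i) := by fun_prop
      exact hk.comp this
  have hG : Continuous fun p : SU2 × SU2 => ∏ i, κ (x i * p.1) (y i * p.2) := by
    refine continuous_finsetProd _ fun i _ => ?_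
    have : Continuous fun p : SU2 × SU2 => (x i * p.1, y i * p.2) := by fun_prop
    exact hk.comp this
  have h1 : ∀ w, ∫ z, F z w = ∏ i, κ (x i * w 0) (y i * w 1) := by
    intro w
    simp only [F, ← Finset.prod_mul_distrib]
    rw [integral_fintype_prod_volume_eq_prod
      (fun i z => κ (x i * w 0) z * κ (y i * w 1) z)]
    refine Finset.prod_congr rfl fun i _ => ?_
    rw [hκ.repr _ (hκ.mem _), hκ.symm]
  symm
  calc _ = ∫ p : (Fin 3 → SU2) × (Fin 2 → SU2), F p.1 p.2 :=
        (volume_measurePreserving_sumPiEquivProdPi fun _ : Fin 3 ⊕ Fin 2 => SU2).integral_comp'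
          fun p : (Fin 3 → SU2) × (Fin 2 → SU2) => F p.1 p.2
    _ = ∫ w, ∫ z, F z w := integral_prod_symm _ (integrable_of_compact hF)
    _ = ∫ w : Fin 2 → SU2, ∏ i, κ (x i * w 0) (y i * w 1) := by simp_rw [h1]
    _ = ∫ p : SU2 × SU2, ∏ i, κ (x i * p.1) (y i * p.2) :=
        (volume_preserving_finTwoArrow SU2).integral_comp'
          fun p : SU2 × SU2 => ∏ i, κ (x i * p.1) (y i * p.2)
    _ = ∫ k, ∫ h, ∏ i, κ (x i * h) (y i * k) := integral_prod_symm _ (integrable_of_compact hG)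
    _ = ∫ k : SU2, ∫ h, ∏ i, κ (x i * h) (y i) := by
        refine integral_congr_ae (.of_forall fun k => ?_)
        dsimp only
        rw [← integral_mul_right_eq_self (fun h => ∏ i, κ (x i * h) (y i * k)) k]
        simp_rw [← mul_assoc, hκ'.mul_right]
    _ = _ := by simp

/-! ### The amplitude as a sum of integrals of products of strands -/

theorem measurePreserving_curry (ι ι' X : Type*) [Fintype ι] [Fintype ι'] [MeasureSpace X]
    [IsProbabilityMeasure (volume : Measure X)] :
    MeasurePreserving (MeasurableEquiv.curry ι ι' X) volume volume := by
  refine ⟨(MeasurableEquiv.curry ι ι' X).measurable, ?_⟩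
  have h := Measure.infinitePi_map_curry fun (_ : ι) (_ : ι') => (volume : Measure X)
  simp only [Measure.infinitePi_eq_pi] at h
  exact h

/-- The assignment of the variables of a graph made of those of its vertices and those of its
lines. -/
def joinVars {V L : Type} (x : V → Fin 6 → SU2) (u : L → Fin 3 ⊕ Fin 2 → SU2) :
    GraphVar V L → SU2 :=
  Sum.elim (fun p => x p.1 p.2) fun p => u p.1 p.2

theorem continuous_joinVars {V L : Type} :
    Continuous fun p : (V → Fin 6 → SU2) × (L → Fin 3 ⊕ Fin 2 → SU2) => joinVars p.1 p.2 := by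
  refine continuous_pi fun i => ?_
  rcases i with ⟨v, i⟩ | ⟨l, i⟩
  · exact (continuous_apply_apply v i).comp continuous_fst
  · exact (continuous_apply_apply l i).comp continuous_snd

/-- Vertex variables and line variables together are the variables of the graph. -/
theorem integral_graphVar {V L : Type} [Fintype V] [Fintype L] {F : (GraphVar V L → SU2) → ℝ}
    (hF : Continuous F) :
    ∫ ω, F ω = ∫ x : V → Fin 6 → SU2, ∫ u : L → Fin 3 ⊕ Fin 2 → SU2,
      F (joinVars x u) := by
  have h1 := volume_measurePreserving_sumPiEquivProdPi fun _ : GraphVar V L => SU2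
  have h2 := (measurePreserving_curry V (Fin 6) SU2).prod
    (measurePreserving_curry L (Fin 3 ⊕ Fin 2) SU2)
  let e := (MeasurableEquiv.sumPiEquivProdPi fun _ : GraphVar V L => SU2).trans
    ((MeasurableEquiv.curry V (Fin 6) SU2).prodCongr (MeasurableEquiv.curry L (Fin 3 ⊕ Fin 2) SU2))
  have he : MeasurePreserving e volume volume := h2.comp h1
  let G : (V → Fin 6 → SU2) × (L → Fin 3 ⊕ Fin 2 → SU2) → ℝ := fun p => F (joinVars p.1 p.2)
  have hG : Continuous G := hF.comp continuous_joinVars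
  calc ∫ ω, F ω = ∫ ω, G (e ω) := by
        refine integral_congr_ae (.of_forall fun ω => congrArg F ?_)
        ext i
        rcases i with i | i <;> rfl
    _ = ∫ p, G p := he.integral_comp' G
    _ = _ := integral_prod _ (integrable_of_compact hG)

/-- The cyclic permutation `c` of the arguments acts at the first end of a line. -/
def endPerm (c : Fin 3) : Fin 2 → Equiv.Perm (Fin 3) :=
  ![Equiv.subRight c, Equiv.refl _]

namespace VacuumGraph

variable {V L : Type} (G : VacuumGraph V L)

/-- The matching of the arguments of the field `e` with the strands of its line, when the covariance
of the line `l` contributes the cyclic permutation `c l`. -/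
def strandPerm (c : L → Fin 3) (e : V × Fin 4) : Equiv.Perm (Fin 3) :=
  endPerm (c (G.ends.symm e).1) (G.ends.symm e).2

theorem prod_covarianceKernel_eq [Fintype V] [Fintype L] [DecidableEq L] {N Λ : ℝ} (hΛ : 0 ≤ Λ)
    {κ : SU2 → SU2 → ℝ} (hκ : IsReproducing ⌊2 * Λ⌋₊ κ) (hκ' : StrandKernel N κ)
    (x : V → Fin 6 → SU2) :
    ∏ l : L, covarianceKernel Λ (G.fieldArgs x (G.ends (l, 0))) (G.fieldArgs x (G.ends (l, 1))) =
      (1 / 3) ^ Fintype.card L * ∑ c : L → Fin 3, ∫ u : L → Fin 3 ⊕ Fin 2 → SU2,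
        ∏ e, ∏ i, strand κ (G.argVar e i) (G.avgVar e) (G.midVar e (G.strandPerm c e i))
          (joinVars x u) := by
  let f : L → Fin 2 → Fin 3 → (Fin 3 ⊕ Fin 2 → SU2) → ℝ := fun l s c u =>
    ∏ i, κ (G.fieldArgs x (G.ends (l, s)) i * u (.inr s)) (u (.inl (endPerm c s i)))
  have h1 : ∀ l, covarianceKernel Λ (G.fieldArgs x (G.ends (l, 0)))
      (G.fieldArgs x (G.ends (l, 1))) = (1 / 3) * ∑ c, ∫ u, ∏ s, f l s c u := by
    intro l
    rw [covarianceKernel_eq hΛ hκ hκ']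
    congr 1
    refine Finset.sum_congr rfl fun c _ => ?_
    rw [integral_prod_kernel_eq hκ hκ' fun i => G.fieldArgs x (G.ends (l, 0)) (i + c)]
    refine integral_congr_ae (.of_forall fun u => ?_)
    dsimp only
    rw [Fin.prod_univ_two]
    congr 1
    rw [← Equiv.prod_comp (Equiv.subRight c)]
    simp [f, endPerm]
  simp_rw [h1]
  rw [Finset.prod_mul_distrib, Finset.prod_const, Finset.card_univ, Finset.prod_univ_sum,
    Fintype.piFinset_univ]
  congr 1
  refine Finset.sum_congr rfl fun c _ => ?_
  rw [← integral_fintype_prod_volume_eq_prod (fun l u => ∏ s, f l s (c l) u)]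
  refine integral_congr_ae (.of_forall fun u => ?_)
  dsimp only
  rw [← Equiv.prod_comp G.ends, Fintype.prod_prod_type]
  simp [f, joinVars, strand, argVar, avgVar, midVar, strandPerm, fieldArgs]

theorem amplitude_eq [Fintype V] [Fintype L] [DecidableEq L] {N δ Λ : ℝ} (hΛ : 0 ≤ Λ)
    {κ : SU2 → SU2 → ℝ} (hκ : IsReproducing ⌊2 * Λ⌋₊ κ) (hκ' : StrandKernel N κ) :
    G.amplitude δ Λ = (∏ v, vertexWeight δ (G.type v)) * ((1 / 3) ^ Fintype.card L *
      ∑ c : L → Fin 3, ∫ ω : GraphVar V L → SU2, ∏ e, ∏ i,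
        strand κ (G.argVar e i) (G.avgVar e) (G.midVar e (G.strandPerm c e i)) ω) := by
  have hcont : ∀ c : L → Fin 3, Continuous fun ω : GraphVar V L → SU2 => ∏ e, ∏ i,
      strand κ (G.argVar e i) (G.avgVar e) (G.midVar e (G.strandPerm c e i)) ω := fun c =>
    continuous_finsetProd _ fun e _ => continuous_finsetProd _ fun i _ => hκ'.continuous_strand ..
  rw [amplitude]
  simp_rw [G.prod_covarianceKernel_eq hΛ hκ hκ']
  rw [integral_const_mul, integral_finsetSum]
  · congr 2
    exact Finset.sum_congr rfl fun c _ => (integral_graphVar (hcont c)).symm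
  · intro c _
    refine integrable_of_compact ?_
    have h := continuous_parametric_integral_of_continuous
      (μ := (volume : Measure (L → Fin 3 ⊕ Fin 2 → SU2)))
      (f := fun (x : V → Fin 6 → SU2) u => ∏ e, ∏ i,
        strand κ (G.argVar e i) (G.avgVar e) (G.midVar e (G.strandPerm c e i))
          (joinVars x u)) ((hcont c).comp continuous_joinVars) isCompact_univ
    rw [Measure.restrict_univ] at h
    exact h

theorem abs_prod_vertexWeight_le [Fintype V] {δ : ℝ} (hδ : |δ| ≤ 1) :
    |∏ v, vertexWeight δ (G.type v)| ≤ (1 / 8) ^ Fintype.card V := by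
  rw [Finset.abs_prod, ← Finset.card_univ, ← Finset.prod_const]
  refine Finset.prod_le_prod (fun v _ => abs_nonneg _) fun v _ => ?_
  rcases G.type v with _ | _
  · rw [vertexWeight, abs_div, abs_neg, abs_of_pos (by norm_num : (0 : ℝ) < 8)]
    linarith
  · norm_num [vertexWeight]

theorem abs_amplitude_le [Fintype V] [Fintype L] (hG : G.Connected) {δ Λ : ℝ} (hδ : |δ| ≤ 1)
    (hΛ : 0 ≤ Λ) : |G.amplitude δ Λ| ≤
      (1 / 8) ^ Fintype.card V * (2 * ((⌊2 * Λ⌋₊ : ℝ) + 1) ^ 3) ^ (Fintype.card V + 2) := by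
  classical
  obtain ⟨κ, hκ, hκ'⟩ := exists_kernel ⌊2 * Λ⌋₊
  have hN : 1 ≤ 2 * ((⌊2 * Λ⌋₊ : ℝ) + 1) ^ 3 := by
    have : (1 : ℝ) ≤ ((⌊2 * Λ⌋₊ : ℝ) + 1) ^ 3 := one_le_pow₀ (by simp)
    linarith
  set N := 2 * ((⌊2 * Λ⌋₊ : ℝ) + 1) ^ 3
  rw [G.amplitude_eq hΛ hκ hκ', abs_mul]
  refine mul_le_mul (G.abs_prod_vertexWeight_le hδ) ?_ (abs_nonneg _) (by positivity)
  rw [abs_mul, abs_of_pos (by positivity : (0 : ℝ) < (1 / 3) ^ Fintype.card L)]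
  calc _ ≤ (1 / 3 : ℝ) ^ Fintype.card L * ∑ c : L → Fin 3, N ^ (Fintype.card V + 2) := by
        refine mul_le_mul_of_nonneg_left ((Finset.abs_sum_le_sum_abs _ _).trans
          (Finset.sum_le_sum fun c _ => ?_)) (by positivity)
        exact G.abs_integral_prod_strand_le hG hN hκ' (G.strandPerm c)
    _ = N ^ (Fintype.card V + 2) := by
        simp

end VacuumGraph

end BFL

theorem theorem2 :
    ∃ K : ℝ, 0 < K ∧ ∀ δ : ℝ, |δ| ≤ 1 → ∀ Λ : ℝ, 1 / 2 ≤ Λ →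
      ∀ (V L : Type) [Fintype V] [Fintype L] (G : BFL.VacuumGraph V L), G.Connected →
        |G.amplitude δ Λ| ≤ K ^ Fintype.card V * Λ ^ (6 + 3 * Fintype.card V) := by
  refine ⟨16 * 128 ^ 2, by norm_num, fun δ hδ Λ hΛ V L _ _ G hG => ?_⟩
  have hV : 1 ≤ Fintype.card V := Fintype.card_pos_iff.2 hG.nonempty
  have hM : (⌊2 * Λ⌋₊ : ℝ) + 1 ≤ 4 * Λ := by
    have := Nat.floor_le (show 0 ≤ 2 * Λ by linarith)
    linarith
  have hN : 2 * ((⌊2 * Λ⌋₊ : ℝ) + 1) ^ 3 ≤ 128 * Λ ^ 3 := by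
    have := pow_le_pow_left₀ (by positivity) hM 3
    linarith [this, mul_pow 4 Λ 3]
  calc _ ≤ (1 / 8 : ℝ) ^ Fintype.card V * (2 * ((⌊2 * Λ⌋₊ : ℝ) + 1) ^ 3) ^ (Fintype.card V + 2) :=
        G.abs_amplitude_le hG hδ (by linarith)
    _ ≤ (1 / 8) ^ Fintype.card V * (128 * Λ ^ 3) ^ (Fintype.card V + 2) := by gcongr
    _ = 16 ^ Fintype.card V * 128 ^ 2 * Λ ^ (6 + 3 * Fintype.card V) := by
        rw [mul_pow, ← pow_mul, pow_add, ← mul_assoc, ← mul_assoc, ← mul_pow]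
        ring_nf
    _ ≤ (16 * 128 ^ 2) ^ Fintype.card V * Λ ^ (6 + 3 * Fintype.card V) := by
        rw [mul_pow]
        gcongr
        -- as there is a vertex, the factor `128 ^ 2` is absorbed in the power
        exact le_self_pow₀ (by norm_num) (by omega)
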